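/- Let $d$ be a natural number and let $\mu_1,\dots,\mu_d$ be Borel probability measures on $\mathbb R^d$. Suppose there are $p_1,\dots,p_d\in(1,+\infty)$ with $\sum_{i=1}^d \frac1{p_i}=1$ and $\int_{\mathbb R^d}|x|^{p_i}\,d\mu_i(x)<+\infty$ for every $i$ (so that in particular $d\ge 2$). Suppose that every $\mu_i$ is absolutely continuous with respect to the Lebesgue measure on $\mathbb R^d$, with a density that is positive (Lebesgue almost everywhere). Consider the dual problem $$(\mathcal D)\qquad \inf\Big\{\sum_{i=1}^d\int_{\mathbb R^d}\varphi_i\,d\mu_i \;:\; (\varphi_1,\dots,\varphi_d)\in\mathcal E\Big\},$$ where $\mathcal E$ is the set of $d$-tuples of lower semicontinuous functions $\varphi_i:\mathbb R^d\to\mathbb R\cup\{+\infty\}$ such that $\sum_{i=1}^d\varphi_i(x_i)\ge\det(x_1,\dots,x_d)$ for all $(x_1,\dots,x_d)\in(\mathbb R^d)^d$; the objective is taken to be $+\infty$ if $\sum_{i}\int\varphi_i^+\,d\mu_i=+\infty$. Then $(\mathcal D)$ has a solution, and it is unique up to the addition of constants summing to $0$: there is a solution $(\varphi_1,\dots,\varphi_d)$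 such that a tuple $(\psi_1,\dots,\psi_d)$ is a solution if and only if there are $c_1,\dots,c_d\in\mathbb R$ with $\sum_i c_i=0$ and $\psi_i=\varphi_i+c_i$ on $\mathbb R^d$ for every $i$. Moreover, let $(\varphi_1,\dots,\varphi_d)$ be any solution of $(\mathcal D)$ and let $\gamma$ be any solution of the primal problem, i.e. a probability measure on $(\mathbb R^d)^d$ that maximizes $\int\det(x_1,\dots,x_d)\,d\gamma$ among all those with marginals $\mu_1,\dots,\mu_d$. For each $i$ let $w_i(x)$ be the signed wedge product of $(x_j)_{j\ne i}$, that is, the vector with $\langle w_i(x),y\rangle=\det(x_1,\dots,x_{i-1},y,x_{i+1},\dots,x_d)$ for all $y\in\mathbb R^d$, and let $\gamma^{a}$ be the conditional law under $\gamma$ of $x=(x_1,\dots,x_d)$ given $x_i=a$. Then, for $\mu_i$-almost every $a$, $\varphi_i$ is finite near $a$ and differentiable at $a$, $w_i$ is $\gamma^{a}$-integrable, and $$\nabla\varphi_i(a)=\int w_i(x)\,d\gamma^{a}(x).$$ -/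

import Mathlib

open MeasureTheory ProbabilityTheory Topology

namespace DetTransport

/-- The space `ℝ^d` with its Euclidean norm and Lebesgue measure. -/
abbrev Vec (d : ℕ) : Type := EuclideanSpace ℝ (Fin d)

/-- `det (x₁, …, x_d)`, the determinant of the matrix with columns `x₁, …, x_d`. -/
noncomputable def detVec {d : ℕ} (x : Fin d → Vec d) : ℝ :=
  Matrix.det (Matrix.of fun k j => x j k)

/-- The signed wedge product `± ⋀_{j ≠ i} x_j`, i.e. the vector `w` characterised by
`⟪w, y⟫ = det (x₁, …, x_{i-1}, y, x_{i+1}, …, x_d)` for all `y` (see `inner_signedWedge`).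
It does not depend on `x i`. -/
noncomputable def signedWedge {d : ℕ} (i : Fin d) (x : Fin d → Vec d) : Vec d :=
  WithLp.toLp 2 fun k => detVec (Function.update x i (EuclideanSpace.single k (1 : ℝ)))

theorem detVec_update {d : ℕ} (i : Fin d) (x : Fin d → Vec d) (y : Vec d) :
    detVec (Function.update x i y) =
      Matrix.det ((Matrix.of fun k j => x j k).updateCol i y.ofLp) := by
  unfold detVec
  congr 1
  ext k j
  by_cases h : j = i
  · subst h; simp
  · simp [h]

theorem inner_signedWedge {d : ℕ} (i : Fin d) (x : Fin d → Vec d) (y : Vec d) :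
    inner ℝ (signedWedge i x) y = detVec (Function.update x i y) := by
  rw [detVec_update, ← Matrix.cramer_apply, PiLp.inner_apply]
  have h : y.ofLp = ∑ k, y.ofLp k • (Pi.single k (1 : ℝ) : Fin d → ℝ) := by
    ext j
    simp [Finset.sum_apply, Pi.single_apply]
  conv_rhs => rw [h]
  rw [map_sum, Finset.sum_apply]
  refine Finset.sum_congr rfl fun k _ => ?_
  rw [map_smul, Pi.smul_apply, Matrix.cramer_apply]
  simp [signedWedge, detVec_update]

/-- `Π(μ₁, …, μ_d)`: the measures on `(ℝ^d)^d` with marginals `μ₁, …, μ_d`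
(probability measures as soon as one `μ i` is). -/
def IsPlan {d : ℕ} (μ : Fin d → Measure (Vec d)) (γ : Measure (Fin d → Vec d)) : Prop :=
  ∀ i, γ.map (fun x => x i) = μ i

/-- `γ` solves the primal problem `sup_{γ ∈ Π(μ₁, …, μ_d)} ∫ det dγ`.
Under the moment assumption of the theorem, `det` is integrable for every plan. -/
def IsOptimalPlan {d : ℕ} (μ : Fin d → Measure (Vec d)) (γ : Measure (Fin d → Vec d)) : Prop :=
  IsPlan μ γ ∧ ∀ γ' : Measure (Fin d → Vec d), IsPlan μ γ' →
    ∫ x, detVec x ∂γ' ≤ ∫ x, detVec x ∂γ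

/-- The admissible set of the dual problem: `d`-tuples of lower semicontinuous functions
`ℝ^d → ℝ ∪ {+∞}` with `∑ φ_i(x_i) ≥ det (x₁, …, x_d)` for all `(x₁, …, x_d)`. -/
structure IsDualAdmissible {d : ℕ} (φ : Fin d → Vec d → EReal) : Prop where
  lsc : ∀ i, LowerSemicontinuous (φ i)
  ne_bot : ∀ i x, φ i x ≠ ⊥
  le_sum : ∀ x : Fin d → Vec d, (detVec x : EReal) ≤ ∑ i, φ i (x i)

/-- `∑ i, ∫ (φ_i)⁺ dμ_i`. -/
noncomputable def posCost {d : ℕ} (μ : Fin d → Measure (Vec d)) (φ : Fin d → Vec d → EReal) :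
    ENNReal :=
  ∑ i, ∫⁻ x, (φ i x).toENNReal ∂(μ i)

/-- `∑ i, ∫ (φ_i)⁻ dμ_i`. -/
noncomputable def negCost {d : ℕ} (μ : Fin d → Measure (Vec d)) (φ : Fin d → Vec d → EReal) :
    ENNReal :=
  ∑ i, ∫⁻ x, (-φ i x).toENNReal ∂(μ i)

open Classical in
/-- The dual objective `∑ i, ∫ φ_i dμ_i`, as an extended real number, with the usual
convention of minimisation problems that it is `+∞` when the positive parts have an
infinite integral. Under the moment assumption of the theorem, if `φ` is admissible and no
`φ_i` is identically `+∞`, the negative parts are integrable (`φ_i` has an affine minorant),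
so that this is the usual sum of integrals in `(-∞, +∞]`. -/
noncomputable def dualCost {d : ℕ} (μ : Fin d → Measure (Vec d)) (φ : Fin d → Vec d → EReal) :
    EReal :=
  if posCost μ φ = ⊤ then ⊤ else (posCost μ φ : EReal) - (negCost μ φ : EReal)

/-- `φ` solves the dual problem: it is admissible and minimises `∑ i, ∫ φ_i dμ_i` among the
admissible tuples. -/
def IsDualSolution {d : ℕ} (μ : Fin d → Measure (Vec d)) (φ : Fin d → Vec d → EReal) : Prop :=
  IsDualAdmissible φ ∧
    ∀ ψ : Fin d → Vec d → EReal, IsDualAdmissible ψ → dualCost μ φ ≤ dualCost μ ψ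

end DetTransport

namespace DetTransport

open Filter Set

/-! The proof is Kantorovich duality with attainment on both sides, followed by first-order
conditions at tight points.

By weighted AM-GM, the determinant is dominated by a multiple of `∑ i, (1 + ‖x i‖ ^ p i)`. On
functions so dominated, the infimal cost of a separable integrable majorant is sublinear.
Hahn–Banach gives a linear functional touching it at `detVec`, and the Riesz theorem turns this into
a plan γ₀ without duality gap (`exists_plan_forall_exists_majorant`). Almost optimal majorants
converge to the determinant γ₀-a.e. along a sequence; suitably normalised, they have ultrafilter
limits in `EReal` that are never `⊥`, which yields potentials tight γ₀-a.e. (`exists_potentials`).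
These may be nonmeasurable, but the determinant is affine in each variable, so passing to affine
hulls keeps the constraint and the tightness and restores lower semicontinuity
(`isDualAdmissible_affineHull`).

Weak duality and its equality case identify the dual solutions with the admissible tuples tight
γ₀-a.e. (`isDualSolution_iff`); they are tight on every optimal plan too. Since each μ_i and
Lebesgue measure have the same null sets, tight potentials are finite convex functions
(`IsDualAdmissible.exists_convexOn`), hence differentiable a.e. At a tight point x, the function
`φ_i - ⟪w_i(x), ·⟫` is minimal at x_i, so `∇φ_i(x_i) = w_i(x)` for γ-a.e. x. The right side does not
involve the potentials, so two solutions have the same gradients a.e. and differ by constants. The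
left side depends on x_i only, so w_i is a.s. constant under γ^a and its mean is the gradient. -/

/-- A sublinear functional is attained at any given point by a linear functional below it. -/
theorem exists_linearMap_le_sublinear_eq {E : Type*} [AddCommGroup E] [Module ℝ E] (N : E → ℝ)
    (N_hom : ∀ t : ℝ, 0 < t → ∀ x, N (t • x) = t * N x) (N_add : ∀ x y, N (x + y) ≤ N x + N y)
    (c : E) : ∃ l : E →ₗ[ℝ] ℝ, l c = N c ∧ ∀ x, l x ≤ N x := by
  have N_zero : N 0 = 0 := by
    have := N_hom 2 two_pos 0
    rw [smul_zero] at this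
    linarith
  have N_neg : ∀ h, -N h ≤ N (-h) := by
    intro h
    have := N_add h (-h)
    rw [add_neg_cancel, N_zero] at this
    linarith
  have hspan : ∀ t : ℝ, t • c = 0 → t • N c = 0 := by
    intro t ht
    rcases smul_eq_zero.1 ht with rfl | rfl
    · simp
    · rw [N_zero, smul_zero]
  obtain ⟨l, hl1, hl⟩ := exists_extension_of_le_sublinear
    (LinearPMap.mkSpanSingleton' c (N c) hspan) N N_hom N_add (by
      rintro ⟨x, hx⟩
      obtain ⟨t, rfl⟩ := Submodule.mem_span_singleton.1 hx
      rw [LinearPMap.mkSpanSingleton'_apply]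
      rcases lt_trichotomy t 0 with ht | rfl | ht
      · have h1 := N_neg ((-t) • c)
        rw [N_hom (-t) (by linarith), neg_smul, neg_neg] at h1
        simpa using h1
      · simp [N_zero]
      · exact (N_hom t ht c).ge)
  refine ⟨l, ?_, hl⟩
  have h1 := hl1 ⟨c, Submodule.mem_span_singleton_self c⟩
  exact h1.trans (LinearPMap.mkSpanSingleton'_apply_self _ _ _ _)

/-! ### Separable majorants and Hahn–Banach -/

section Duality

variable {ι Y : Type*} [Fintype ι]

/-- The functions on a product that are bounded by a multiple of `∑ i, a i (x i)`. -/
def dominated (a : ι → Y → ℝ) : Submodule ℝ ((ι → Y) → ℝ) where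
  carrier := {h | ∃ C, ∀ x, |h x| ≤ C * ∑ i, a i (x i)}
  zero_mem' := ⟨0, by simp⟩
  add_mem' := by
    rintro f g ⟨C, hC⟩ ⟨D, hD⟩
    exact ⟨C + D, fun x => (abs_add_le _ _).trans (by rw [add_mul]; exact add_le_add (hC x) (hD x))⟩
  smul_mem' := by
    rintro c f ⟨C, hC⟩
    refine ⟨|c| * C, fun x => ?_⟩
    rw [Pi.smul_apply, smul_eq_mul, abs_mul, mul_assoc]
    exact mul_le_mul_of_nonneg_left (hC x) (abs_nonneg c)

variable [MeasurableSpace Y]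

/-- The costs of the separable integrable majorants of `h`. -/
def majorantCosts (μ : ι → Measure Y) (h : (ι → Y) → ℝ) : Set ℝ :=
  {s | ∃ f : ι → Y → ℝ, (∀ i, Integrable (f i) (μ i)) ∧ (∀ x, h x ≤ ∑ i, f i (x i)) ∧
    s = ∑ i, ∫ y, f i y ∂μ i}

/-- Each function is at most its mean at some point; evaluating the hypothesis at those points
avoids any coupling. -/
theorem sum_integral_nonneg_of_sum_nonneg {μ : ι → Measure Y} [∀ i, IsProbabilityMeasure (μ i)]
    {f : ι → Y → ℝ} (hf : ∀ i, Integrable (f i) (μ i)) (h : ∀ x : ι → Y, 0 ≤ ∑ i, f i (x i)) :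
    0 ≤ ∑ i, ∫ y, f i y ∂μ i := by
  choose x hx using fun i => exists_le_integral (hf i)
  exact (h x).trans (Finset.sum_le_sum fun i _ => hx i)

variable {μ : ι → Measure Y} {a : ι → Y → ℝ}

theorem majorantCosts_nonempty (hai : ∀ i, Integrable (a i) (μ i)) (h : dominated a) :
    (majorantCosts μ h.1).Nonempty := by
  obtain ⟨C, hC⟩ := h.2
  refine ⟨_, fun i y => C * a i y, fun i => (hai i).const_mul C, fun x => ?_, rfl⟩
  rw [← Finset.mul_sum]
  exact (le_abs_self _).trans (hC x)

theorem majorantCosts_bddBelow [∀ i, IsProbabilityMeasure (μ i)] (hai : ∀ i, Integrable (a i) (μ i))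
    (h : dominated a) : BddBelow (majorantCosts μ h.1) := by
  obtain ⟨C, hC⟩ := h.2
  refine ⟨-∑ i, ∫ y, C * a i y ∂μ i, ?_⟩
  rintro s ⟨f, hf, hfh, rfl⟩
  have key := sum_integral_nonneg_of_sum_nonneg (μ := μ) (f := fun i y => f i y + C * a i y)
    (fun i => (hf i).add ((hai i).const_mul C)) (fun x => by
      rw [Finset.sum_add_distrib, ← Finset.mul_sum]
      linarith [neg_abs_le (h.1 x), hC x, hfh x])
  have : ∑ i, ∫ y, f i y + C * a i y ∂μ i = ∑ i, ∫ y, f i y ∂μ i + ∑ i, ∫ y, C * a i y ∂μ i := by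
    rw [← Finset.sum_add_distrib]
    exact Finset.sum_congr rfl fun i _ => integral_add (hf i) ((hai i).const_mul C)
  linarith

/-- Hahn–Banach form of the Kantorovich duality. -/
theorem exists_dual_functional [∀ i, IsProbabilityMeasure (μ i)] (hai : ∀ i, Integrable (a i) (μ i))
    (c : dominated a) :
    ∃ l : dominated a →ₗ[ℝ] ℝ,
      (∀ (h : dominated a) (f : ι → Y → ℝ), (∀ i, Integrable (f i) (μ i)) →
        (∀ x, h.1 x ≤ ∑ i, f i (x i)) → l h ≤ ∑ i, ∫ y, f i y ∂μ i) ∧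
      ∀ ε > 0, ∃ f : ι → Y → ℝ, (∀ i, Integrable (f i) (μ i)) ∧ (∀ x, c.1 x ≤ ∑ i, f i (x i)) ∧
        ∑ i, ∫ y, f i y ∂μ i ≤ l c + ε := by
  let N : dominated a → ℝ := fun h => sInf (majorantCosts μ h.1)
  have hN_le : ∀ (h : dominated a) (f : ι → Y → ℝ), (∀ i, Integrable (f i) (μ i)) →
      (∀ x, h.1 x ≤ ∑ i, f i (x i)) → N h ≤ ∑ i, ∫ y, f i y ∂μ i := fun h f hf hh =>
    csInf_le (majorantCosts_bddBelow hai h) ⟨f, hf, hh, rfl⟩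
  have hN_ex : ∀ (h : dominated a), ∀ ε > 0, ∃ f : ι → Y → ℝ, (∀ i, Integrable (f i) (μ i)) ∧
      (∀ x, h.1 x ≤ ∑ i, f i (x i)) ∧ ∑ i, ∫ y, f i y ∂μ i ≤ N h + ε := by
    intro h ε hε
    obtain ⟨s, ⟨f, hf, hh, rfl⟩, hs⟩ := Real.lt_sInf_add_pos (majorantCosts_nonempty hai h) hε
    exact ⟨f, hf, hh, hs.le⟩
  have N_add : ∀ x y, N (x + y) ≤ N x + N y := by
    intro h k
    refine le_of_forall_pos_le_add fun ε hε => ?_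
    obtain ⟨f, hf, hfh, hfe⟩ := hN_ex h (ε / 2) (by positivity)
    obtain ⟨g, hg, hgk, hge⟩ := hN_ex k (ε / 2) (by positivity)
    have := hN_le (h + k) (fun i y => f i y + g i y) (fun i => (hf i).add (hg i)) (fun x => by
      rw [Finset.sum_add_distrib]
      exact add_le_add (hfh x) (hgk x))
    have e : ∑ i, ∫ y, f i y + g i y ∂μ i = ∑ i, ∫ y, f i y ∂μ i + ∑ i, ∫ y, g i y ∂μ i := by
      rw [← Finset.sum_add_distrib]
      exact Finset.sum_congr rfl fun i _ => integral_add (hf i) (hg i)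
    linarith
  have N_le : ∀ t : ℝ, 0 < t → ∀ h, N (t • h) ≤ t * N h := by
    intro t ht h
    refine le_of_forall_pos_le_add fun ε hε => ?_
    obtain ⟨f, hf, hfh, hfe⟩ := hN_ex h (ε / t) (by positivity)
    have := hN_le (t • h) (fun i y => t * f i y) (fun i => (hf i).const_mul t) (fun x => by
      rw [← Finset.mul_sum]
      exact mul_le_mul_of_nonneg_left (hfh x) ht.le)
    simp only [integral_const_mul, ← Finset.mul_sum] at this
    have := this.trans (mul_le_mul_of_nonneg_left hfe ht.le)
    rwa [mul_add, mul_div_cancel₀ _ ht.ne'] at this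
  have N_hom : ∀ t : ℝ, 0 < t → ∀ h, N (t • h) = t * N h := by
    intro t ht h
    refine le_antisymm (N_le t ht h) ?_
    have := N_le t⁻¹ (inv_pos.2 ht) (t • h)
    rw [inv_smul_smul₀ ht.ne'] at this
    calc t * N h ≤ t * (t⁻¹ * N (t • h)) := mul_le_mul_of_nonneg_left this ht.le
      _ = N (t • h) := by field_simp
  clear_value N
  obtain ⟨l, hlc, hl⟩ := exists_linearMap_le_sublinear_eq N N_hom N_add c
  refine ⟨l, fun h f hf hh => (hl h).trans (hN_le h f hf hh), fun ε hε => ?_⟩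
  rw [hlc]
  exact hN_ex c ε hε

end Duality

/-! ### Cutoffs and tail bounds -/

section Riesz

variable {ι Y : Type*} [Fintype ι]

/-- Cutoff functions along the sublevel sets of `∑ i, a i (x i)`. -/
def cutoff (a : ι → Y → ℝ) (n : ℕ) (x : ι → Y) : ℝ :=
  max 0 (min 1 (n + 1 - ∑ i, a i (x i)))

variable {a : ι → Y → ℝ}

theorem cutoff_nonneg (n : ℕ) (x : ι → Y) : 0 ≤ cutoff a n x := le_max_left _ _

theorem cutoff_le_one (n : ℕ) (x : ι → Y) : cutoff a n x ≤ 1 :=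
  max_le zero_le_one (min_le_left _ _)

theorem cutoff_mono (x : ι → Y) : Monotone fun n => cutoff a n x := by
  intro m n hmn
  have : (m : ℝ) ≤ n := Nat.cast_le.2 hmn
  exact max_le_max le_rfl (min_le_min le_rfl (by linarith))

theorem cutoff_eq_one {n : ℕ} {x : ι → Y} (h : ∑ i, a i (x i) ≤ n) : cutoff a n x = 1 := by
  unfold cutoff
  rw [min_eq_left (by linarith), max_eq_right zero_le_one]

theorem cutoff_eq_zero {n : ℕ} {x : ι → Y} (h : n + 1 ≤ ∑ i, a i (x i)) : cutoff a n x = 0 := by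
  unfold cutoff
  exact max_eq_left ((min_le_right _ _).trans (by linarith))

theorem tendsto_cutoff (x : ι → Y) : Tendsto (fun n => cutoff a n x) atTop (𝓝 1) := by
  obtain ⟨N, hN⟩ := exists_nat_ge (∑ i, a i (x i))
  refine tendsto_const_nhds.congr' ?_
  filter_upwards [eventually_ge_atTop N] with n hn
  exact (cutoff_eq_one (hN.trans (Nat.cast_le.2 hn))).symm

theorem cutoff_mul_mem {h : (ι → Y) → ℝ} (hh : h ∈ dominated a) (n : ℕ) :
    (fun x => h x * cutoff a n x) ∈ dominated a := by
  obtain ⟨C, hC⟩ := hh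
  refine ⟨C, fun x => ?_⟩
  rw [abs_mul, abs_of_nonneg (cutoff_nonneg n x)]
  exact (mul_le_of_le_one_right (abs_nonneg _) (cutoff_le_one n x)).trans (hC x)

theorem continuous_cutoff [TopologicalSpace Y] (hac : ∀ i, Continuous (a i)) (n : ℕ) :
    Continuous (cutoff a n) := by
  unfold cutoff
  fun_prop

theorem hasCompactSupport_cutoff [TopologicalSpace Y] [T2Space Y] (hac : ∀ i, Continuous (a i))
    (ha0 : ∀ i y, 0 ≤ a i y) (haK : ∀ i R, IsCompact {y | a i y ≤ R}) (n : ℕ) :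
    HasCompactSupport (cutoff a n) := by
  have hcl : IsClosed {x : ι → Y | ∑ i, a i (x i) ≤ n + 1} :=
    isClosed_le (by fun_prop) continuous_const
  have hK : IsCompact {x : ι → Y | ∑ i, a i (x i) ≤ n + 1} := by
    refine (isCompact_univ_pi fun i => haK i (n + 1)).of_isClosed_subset hcl fun x hx i _ => ?_
    exact (Finset.single_le_sum (f := fun i => a i (x i)) (fun i _ => ha0 i _)
      (Finset.mem_univ i)).trans hx
  refine HasCompactSupport.of_support_subset_isCompact hK fun x hx => ?_
  by_contra hx'
  exact hx (cutoff_eq_zero (not_le.1 hx').le)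

/-- The largest term is at least the average, so it exceeds `R / card ι` and survives in its
indicator. This makes the tail of a dominated function separably small. -/
theorem sum_le_card_mul_sum_indicator (ha0 : ∀ i y, 0 ≤ a i y) {R : ℝ} {x : ι → Y}
    (hx : R < ∑ i, a i (x i)) :
    ∑ i, a i (x i) ≤
      ∑ i, Fintype.card ι * {y | R / Fintype.card ι < a i y}.indicator (a i) (x i) := by
  cases isEmpty_or_nonempty ι
  · simp
  obtain ⟨j, hj⟩ := Finite.exists_max fun i => a i (x i)
  have hcard : (0 : ℝ) < Fintype.card ι := Nat.cast_pos.2 Fintype.card_pos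
  have hsum : ∑ i, a i (x i) ≤ Fintype.card ι * a j (x j) := by
    simpa using Finset.sum_le_card_nsmul Finset.univ (fun i => a i (x i)) _ fun i _ => hj i
  have hmem : x j ∈ {y | R / Fintype.card ι < a j y} := by
    rw [mem_ofPred_eq, div_lt_iff₀ hcard]
    linarith
  refine hsum.trans ?_
  conv_lhs => rw [← indicator_of_mem hmem (a j)]
  exact Finset.single_le_sum
    (f := fun i => Fintype.card ι * {y | R / Fintype.card ι < a i y}.indicator (a i) (x i))
    (fun i _ => mul_nonneg hcard.le (indicator_nonneg (fun y _ => ha0 i y) _)) (Finset.mem_univ j)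

end Riesz

/-! ### Positivity and continuity of majorized functionals -/

section Functional

variable {ι Y : Type*} [Fintype ι] [MeasurableSpace Y] {μ : ι → Measure Y} {a : ι → Y → ℝ}

/-- A linear functional bounded above by the costs of separable majorants. -/
def IsMajorized (μ : ι → Measure Y) (l : dominated a →ₗ[ℝ] ℝ) : Prop :=
  ∀ (h : dominated a) (f : ι → Y → ℝ), (∀ i, Integrable (f i) (μ i)) →
    (∀ x, h.1 x ≤ ∑ i, f i (x i)) → l h ≤ ∑ i, ∫ y, f i y ∂μ i

variable {l : dominated a →ₗ[ℝ] ℝ}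

theorem IsMajorized.mono (hl : IsMajorized μ l) {h k : dominated a} (hhk : ∀ x, h.1 x ≤ k.1 x) :
    l h ≤ l k := by
  have := hl (h - k) (fun _ _ => 0) (fun i => integrable_zero _ _ _) (fun x => by
    simpa using hhk x)
  simp only [map_sub, integral_zero, Finset.sum_const_zero] at this
  linarith

theorem IsMajorized.eq_sum_integral (hl : IsMajorized μ l) {h : dominated a} {f : ι → Y → ℝ}
    (hf : ∀ i, Integrable (f i) (μ i)) (hh : ∀ x, h.1 x = ∑ i, f i (x i)) :
    l h = ∑ i, ∫ y, f i y ∂μ i := by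
  refine le_antisymm (hl h f hf fun x => (hh x).le) ?_
  have := hl (-h) (fun i y => -f i y) (fun i => (hf i).neg) (fun x => by
    simpa using (hh x).ge)
  simp only [map_neg, integral_neg, Finset.sum_neg_distrib] at this
  linarith

/-- No mass escapes to infinity: the part removed by the cutoff has a separable majorant made of the
tails of the `a i`, whose integrals tend to zero. This replaces tightness. -/
theorem IsMajorized.tendsto_cutoff (hl : IsMajorized μ l) (ham : ∀ i, Measurable (a i))
    (ha0 : ∀ i y, 0 ≤ a i y) (hai : ∀ i, Integrable (a i) (μ i)) (h : dominated a)
    (hh : ∀ x, 0 ≤ h.1 x) :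
    Tendsto (fun n => l ⟨_, cutoff_mul_mem h.2 n⟩) atTop (𝓝 (l h)) := by
  obtain ⟨C, hC⟩ := h.2
  let f : ℕ → ι → Y → ℝ := fun n i y => 
    |C| * (Fintype.card ι * {y | (n : ℝ) / Fintype.card ι < a i y}.indicator (a i) y)
  have hms : ∀ (n : ℕ) i, MeasurableSet {y | (n : ℝ) / Fintype.card ι < a i y} := fun n i =>
    measurableSet_lt measurable_const (ham i)
  have hf : ∀ n i, Integrable (f n i) (μ i) := fun n i =>
    (((hai i).indicator (hms n i)).const_mul _).const_mul _
  have hlow : ∀ n, l h - ∑ i, ∫ y, f n i y ∂μ i ≤ l ⟨_, cutoff_mul_mem h.2 n⟩ := by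
    intro n
    have := hl (h - ⟨_, cutoff_mul_mem h.2 n⟩) (f n) (hf n) (fun x => by
      change h.1 x - h.1 x * cutoff a n x ≤ _
      by_cases hx : ∑ i, a i (x i) ≤ n
      · rw [cutoff_eq_one hx, mul_one, sub_self]
        refine Finset.sum_nonneg fun i _ => mul_nonneg (abs_nonneg _) (mul_nonneg (by positivity)
          (indicator_nonneg (fun y _ => ha0 i y) _))
      · have h0 : h.1 x - h.1 x * cutoff a n x ≤ h.1 x := by
          linarith [mul_nonneg (hh x) (cutoff_nonneg (a := a) n x)]
        have hS : 0 ≤ ∑ i, a i (x i) := Finset.sum_nonneg fun i _ => ha0 i _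
        calc h.1 x - h.1 x * cutoff a n x ≤ |C| * ∑ i, a i (x i) :=
              h0.trans ((le_abs_self _).trans ((hC x).trans
                (mul_le_mul_of_nonneg_right (le_abs_self C) hS)))
          _ ≤ |C| * _ := mul_le_mul_of_nonneg_left
              (sum_le_card_mul_sum_indicator ha0 (not_le.1 hx)) (abs_nonneg _)
          _ = _ := Finset.mul_sum _ _ _)
    rw [map_sub] at this
    linarith
  have hup : ∀ n, l ⟨_, cutoff_mul_mem h.2 n⟩ ≤ l h := fun n =>
    hl.mono fun x => mul_le_of_le_one_right (hh x) (cutoff_le_one n x)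
  have htail : Tendsto (fun n => ∑ i, ∫ y, f n i y ∂μ i) atTop (𝓝 0) := by
    have : ∀ i, Tendsto (fun n => ∫ y, f n i y ∂μ i) atTop (𝓝 0) := by
      intro i
      have hcard : (0 : ℝ) < Fintype.card ι := Nat.cast_pos.2 (Fintype.card_pos_iff.2 ⟨i⟩)
      have h1 := tendsto_setIntegral_of_antitone (μ := μ i) (f := a i) (fun n => hms n i)
        (by
          intro m n hmn y hy
          exact lt_of_le_of_lt (div_le_div_of_nonneg_right (Nat.cast_le.2 hmn) hcard.le) hy)
        ⟨0, (hai i).integrableOn⟩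
      have h2 : ⋂ n : ℕ, {y | (n : ℝ) / Fintype.card ι < a i y} = ∅ := by
        refine eq_empty_of_forall_notMem fun y hy => ?_
        obtain ⟨N, hN⟩ := exists_nat_ge (a i y * Fintype.card ι)
        have := mem_iInter.1 hy N
        rw [mem_ofPred_eq, div_lt_iff₀ hcard] at this
        linarith
      rw [h2, setIntegral_empty] at h1
      have h3 := (h1.const_mul (Fintype.card ι : ℝ)).const_mul |C|
      rw [mul_zero, mul_zero] at h3
      refine h3.congr fun n => ?_
      simp only [f]
      rw [integral_const_mul, integral_const_mul, integral_indicator (hms n i)]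
    simpa using tendsto_finsetSum Finset.univ fun i _ => this i
  refine tendsto_of_tendsto_of_tendsto_of_le_of_le ?_ tendsto_const_nhds hlow hup
  simpa using (tendsto_const_nhds (x := l h)).sub htail

end Functional

/-! ### Riesz representation on dominated continuous functions -/

section Representation

variable {ι Y : Type*} [Fintype ι] [MeasurableSpace Y] {μ : ι → Measure Y} {a : ι → Y → ℝ}
  [TopologicalSpace Y] [T2Space Y] [LocallyCompactSpace Y] [SecondCountableTopology Y]
  [BorelSpace Y] {l : dominated a →ₗ[ℝ] ℝ}

omit [MeasurableSpace Y] [T2Space Y] [LocallyCompactSpace Y] [SecondCountableTopology Y]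
  [BorelSpace Y] in
theorem mem_dominated_of_compactSupport (ha1 : ∀ i y, 1 ≤ a i y)
    [Nonempty ι] {h : (ι → Y) → ℝ} (hc : Continuous h) (hs : HasCompactSupport h) :
    h ∈ dominated a := by
  obtain ⟨C, hC⟩ := hc.bounded_above_of_compact_support hs
  refine ⟨C, fun x => ?_⟩
  obtain ⟨i⟩ := ‹Nonempty ι›
  have h1 : (1 : ℝ) ≤ ∑ i, a i (x i) := (ha1 i (x i)).trans
    (Finset.single_le_sum (f := fun i => a i (x i))
      (fun i _ => zero_le_one.trans (ha1 i _)) (Finset.mem_univ i))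
  have h0 := (norm_nonneg _).trans (hC x)
  exact (hC x).trans (le_mul_of_one_le_right h0 h1)

open scoped CompactlySupported in
/-- A majorized functional is integration against a measure on dominated continuous functions. -/
theorem IsMajorized.exists_measure [Nonempty ι] (hl : IsMajorized μ l)
    (hac : ∀ i, Continuous (a i)) (ha1 : ∀ i y, 1 ≤ a i y)
    (haK : ∀ i R, IsCompact {y | a i y ≤ R}) (hai : ∀ i, Integrable (a i) (μ i)) :
    ∃ γ : Measure (ι → Y), ∀ h : dominated a, Continuous h.1 →
      Integrable h.1 γ ∧ ∫ x, h.1 x ∂γ = l h := by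
  have ha0 : ∀ i y, 0 ≤ a i y := fun i y => zero_le_one.trans (ha1 i y)
  have hmem : ∀ f : C_c(ι → Y, ℝ), ⇑f ∈ dominated a := fun f =>
    mem_dominated_of_compactSupport ha1 f.continuous f.hasCompactSupport
  let L : C_c(ι → Y, ℝ) →ₗ[ℝ] ℝ :=
    { toFun := fun f => l ⟨f, hmem f⟩
      map_add' := fun f g => l.map_add ⟨f, hmem f⟩ ⟨g, hmem g⟩
      map_smul' := fun t f => l.map_smul t ⟨f, hmem f⟩ }
  let Λ : C_c(ι → Y, ℝ) →ₚ[ℝ] ℝ := PositiveLinearMap.mk₀ L (fun f hf => by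
    have := hl.mono (h := 0) (k := ⟨f, hmem f⟩) (fun x => hf x)
    rwa [map_zero] at this)
  let γ := RealRMK.rieszMeasure Λ
  have hγ : ∀ (f : dominated a), Continuous f.1 → HasCompactSupport f.1 →
      ∫ x, f.1 x ∂γ = l f := fun f hc hs => RealRMK.integral_rieszMeasure Λ ⟨⟨f.1, hc⟩, hs⟩
  have hpos : ∀ h : dominated a, Continuous h.1 → (∀ x, 0 ≤ h.1 x) →
      Integrable h.1 γ ∧ ∫ x, h.1 x ∂γ = l h := by
    intro h hc h0
    have hcont : ∀ n, Continuous fun x => h.1 x * cutoff a n x := fun n =>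
      hc.mul (continuous_cutoff hac n)
    have hsupp : ∀ n, HasCompactSupport fun x => h.1 x * cutoff a n x := fun n =>
      (hasCompactSupport_cutoff hac ha0 haK n).mul_left
    have h1 := lintegral_tendsto_of_tendsto_of_monotone (μ := γ)
      (f := fun n x => ENNReal.ofReal (h.1 x * cutoff a n x)) (F := fun x => ENNReal.ofReal (h.1 x))
      (fun n => (hcont n).measurable.ennreal_ofReal.aemeasurable)
      (.of_forall fun x m n hmn => ENNReal.ofReal_le_ofReal
        (mul_le_mul_of_nonneg_left (cutoff_mono x hmn) (h0 x)))
      (.of_forall fun x => ENNReal.tendsto_ofReal (by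
        simpa using (DetTransport.tendsto_cutoff x).const_mul (h.1 x)))
    have h2 : ∀ n, ∫⁻ x, ENNReal.ofReal (h.1 x * cutoff a n x) ∂γ =
        ENNReal.ofReal (l ⟨_, cutoff_mul_mem h.2 n⟩) := by
      intro n
      rw [← hγ ⟨_, cutoff_mul_mem h.2 n⟩ (hcont n) (hsupp n),
        ofReal_integral_eq_lintegral_ofReal ((hcont n).integrable_of_hasCompactSupport (hsupp n))
          (.of_forall fun x => mul_nonneg (h0 x) (cutoff_nonneg n x))]
    simp only [h2] at h1
    have h3 := ENNReal.tendsto_ofReal (hl.tendsto_cutoff (fun i => (hac i).measurable) ha0 hai h h0)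
    have h4 : ∫⁻ x, ENNReal.ofReal (h.1 x) ∂γ = ENNReal.ofReal (l h) := tendsto_nhds_unique h1 h3
    have hl0 : 0 ≤ l h := by
      have := hl.mono (h := 0) (k := h) h0
      rwa [map_zero] at this
    refine ⟨⟨hc.aestronglyMeasurable, ?_⟩, ?_⟩
    · rw [hasFiniteIntegral_iff_ofReal (.of_forall h0), h4]
      exact ENNReal.ofReal_lt_top
    · rw [integral_eq_lintegral_of_nonneg_ae (.of_forall h0) hc.aestronglyMeasurable, h4,
        ENNReal.toReal_ofReal hl0]
  refine ⟨γ, fun h hc => ?_⟩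
  obtain ⟨C, hC⟩ := h.2
  -- Signed functions reduce to nonnegative ones through `h = (h + k) - k`, where `k` dominates
  -- `|h|`.
  let k : dominated a := ⟨fun x => |C| * ∑ i, a i (x i), |C|, fun x => by
    rw [abs_of_nonneg (mul_nonneg (abs_nonneg _) (Finset.sum_nonneg fun i _ => ha0 i _))]⟩
  have hkc : Continuous k.1 := by
    change Continuous fun x : ι → Y => |C| * ∑ i, a i (x i)
    fun_prop
  have hk0 : ∀ x, 0 ≤ k.1 x := fun x =>
    mul_nonneg (abs_nonneg _) (Finset.sum_nonneg fun i _ => ha0 i _)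
  have hk := hpos k hkc hk0
  have hhk := hpos (h + k) (hc.add hkc) (fun x => by
    have h1 : C * ∑ i, a i (x i) ≤ k.1 x := mul_le_mul_of_nonneg_right (le_abs_self C)
      (Finset.sum_nonneg fun i _ => ha0 i _)
    change 0 ≤ h.1 x + k.1 x
    linarith [neg_abs_le (h.1 x), hC x])
  have e : h.1 = fun x => (h + k).1 x - k.1 x := by
    ext x
    change _ = h.1 x + k.1 x - k.1 x
    ring
  constructor
  · rw [e]
    exact hhk.1.sub hk.1
  · rw [e, integral_sub hhk.1 hk.1, hhk.2, hk.2, map_add]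
    ring

end Representation

/-! ### Finite sums in the extended reals -/

section EReal

variable {ι : Type*}

theorem ereal_sum_ne_bot {u : ι → EReal} {s : Finset ι} (h : ∀ i ∈ s, u i ≠ ⊥) :
    ∑ i ∈ s, u i ≠ ⊥ := by
  classical
  induction s using Finset.induction_on with
  | empty => simp
  | insert i s hi ih =>
    rw [Finset.sum_insert hi]
    exact EReal.add_ne_bot_iff.2 ⟨h i (Finset.mem_insert_self i s),
      ih fun j hj => h j (Finset.mem_insert_of_mem hj)⟩

theorem ereal_sum_eq_top {u : ι → EReal} {s : Finset ι} (h : ∀ i ∈ s, u i ≠ ⊥) {i : ι}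
    (hi : i ∈ s) (htop : u i = ⊤) : ∑ j ∈ s, u j = ⊤ := by
  classical
  rw [← Finset.add_sum_erase s u hi, htop]
  exact EReal.top_add_of_ne_bot (ereal_sum_ne_bot fun j hj => h j (Finset.mem_of_mem_erase hj))

theorem ereal_coe_sum (u : ι → ℝ) (s : Finset ι) :
    ((∑ i ∈ s, u i : ℝ) : EReal) = ∑ i ∈ s, (u i : EReal) := by
  classical
  induction s using Finset.induction_on with
  | empty => simp
  | insert i s hi ih => rw [Finset.sum_insert hi, Finset.sum_insert hi, EReal.coe_add, ih]

/-- Excluding `⊥` from the limits avoids the discontinuity of addition at `⊤ + ⊥`. -/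
theorem tendsto_ereal_sum {α : Type*} {l : Filter α} {u : α → ι → EReal} {v : ι → EReal}
    {s : Finset ι} (hv : ∀ i ∈ s, v i ≠ ⊥) (h : ∀ i ∈ s, Tendsto (fun n => u n i) l (𝓝 (v i))) :
    Tendsto (fun n => ∑ i ∈ s, u n i) l (𝓝 (∑ i ∈ s, v i)) := by
  classical
  induction s using Finset.induction_on with
  | empty => simpa using tendsto_const_nhds
  | insert i s hi ih =>
    simp only [Finset.sum_insert hi]
    have h1 := h i (Finset.mem_insert_self i s)
    have h2 := ih (fun j hj => hv j (Finset.mem_insert_of_mem hj))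
      (fun j hj => h j (Finset.mem_insert_of_mem hj))
    exact (EReal.continuousAt_add (p := (v i, ∑ j ∈ s, v j))
      (.inr (ereal_sum_ne_bot fun j hj => hv j (Finset.mem_insert_of_mem hj)))
      (.inl (hv i (Finset.mem_insert_self i s)))).tendsto.comp (h1.prodMk_nhds h2)

end EReal

/-! ### Existence of a plan without duality gap -/

section Plan

variable {ι Y : Type*} [Fintype ι] [Nonempty ι] [MeasurableSpace Y] {μ : ι → Measure Y}
  [∀ i, IsProbabilityMeasure (μ i)] {a : ι → Y → ℝ}
  [MetricSpace Y] [LocallyCompactSpace Y] [SecondCountableTopology Y] [BorelSpace Y]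

/-- Kantorovich duality, with attainment of the primal problem. -/
theorem exists_plan_forall_exists_majorant (hac : ∀ i, Continuous (a i)) (ha1 : ∀ i y, 1 ≤ a i y)
    (haK : ∀ i R, IsCompact {y | a i y ≤ R}) (hai : ∀ i, Integrable (a i) (μ i))
    {c : (ι → Y) → ℝ} (hc : Continuous c) (hcd : c ∈ dominated a) :
    ∃ γ : Measure (ι → Y), IsProbabilityMeasure γ ∧ (∀ i, γ.map (fun x => x i) = μ i) ∧
      ∀ ε > 0, ∃ f : ι → Y → ℝ, (∀ i, Integrable (f i) (μ i)) ∧ (∀ x, c x ≤ ∑ i, f i (x i)) ∧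
        ∑ i, ∫ y, f i y ∂μ i ≤ ∫ x, c x ∂γ + ε := by
  classical
  obtain ⟨l, hl, hle⟩ := exists_dual_functional hai ⟨c, hcd⟩
  obtain ⟨γ, hγ⟩ := IsMajorized.exists_measure hl hac ha1 haK hai
  have hbdd : ∀ {h : (ι → Y) → ℝ} {C : ℝ}, (∀ x, |h x| ≤ C) → h ∈ dominated a := by
    intro h C hC
    refine ⟨C, fun x => ?_⟩
    obtain ⟨i⟩ := ‹Nonempty ι›
    have h1 : (1 : ℝ) ≤ ∑ i, a i (x i) := (ha1 i (x i)).trans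
      (Finset.single_le_sum (f := fun i => a i (x i))
        (fun i _ => zero_le_one.trans (ha1 i _)) (Finset.mem_univ i))
    exact (hC x).trans (le_mul_of_one_le_right ((abs_nonneg _).trans (hC x)) h1)
  have hfin : IsFiniteMeasure γ := by
    have h1 := (hγ ⟨fun _ => 1, hbdd (C := 1) (by simp)⟩ continuous_const).1
    simpa [integrable_const_iff] using h1
  have hmarg : ∀ i, γ.map (fun x => x i) = μ i := by
    intro i
    refine ext_of_forall_integral_eq_of_IsFiniteMeasure fun g => ?_
    have hg : Continuous fun x : ι → Y => g (x i) := g.continuous.comp (continuous_apply i)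
    rw [integral_map (measurable_pi_apply i).aemeasurable g.continuous.aestronglyMeasurable]
    rw [(hγ ⟨fun x => g (x i), hbdd fun x => g.norm_coe_le_norm (x i)⟩ hg).2]
    rw [IsMajorized.eq_sum_integral hl (f := fun j y => if j = i then g y else 0)]
    · rw [Finset.sum_eq_single i]
      · simp
      · intro j _ hj
        simp [hj]
      · simp
    · intro j
      by_cases hj : j = i
      · simpa [hj] using g.integrable (μ i)
      · simp [hj]
    · intro x
      simp
  have hprob : IsProbabilityMeasure γ := by
    obtain ⟨i⟩ := ‹Nonempty ι›
    have : IsProbabilityMeasure (γ.map fun x => x i) := hmarg i ▸ inferInstance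
    exact Measure.isProbabilityMeasure_of_map fun x : ι → Y => x i
  refine ⟨γ, hprob, hmarg, fun ε hε => ?_⟩
  rw [(hγ ⟨c, hcd⟩ hc).2]
  exact hle ε hε

end Plan

/-! ### Limits of almost optimal majorants -/

section DualOptimizer

variable {ι Y : Type*} [Fintype ι] [MeasurableSpace Y] {μ : ι → Measure Y}

theorem integral_sum_apply {γ : Measure (ι → Y)} (hγ : ∀ i, γ.map (fun x => x i) = μ i)
    {f : ι → Y → ℝ} (hf : ∀ i, Integrable (f i) (μ i)) :
    Integrable (fun x => ∑ i, f i (x i)) γ ∧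
      ∫ x, ∑ i, f i (x i) ∂γ = ∑ i, ∫ y, f i y ∂μ i := by
  have hi : ∀ i, Integrable (fun x : ι → Y => f i (x i)) γ := fun i => by
    have := hf i
    rw [← hγ i] at this
    exact this.comp_measurable (measurable_pi_apply i)
  refine ⟨integrable_finsetSum _ fun i _ => hi i, ?_⟩
  rw [integral_finsetSum _ fun i _ => hi i]
  refine Finset.sum_congr rfl fun i _ => ?_
  have := hf i
  rw [← hγ i] at this ⊢
  rw [integral_map (measurable_pi_apply i).aemeasurable this.aestronglyMeasurable]

/-- Almost optimal majorants converge to the cost almost everywhere, along a sequence. -/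
theorem exists_seq_majorant_tendsto {γ : Measure (ι → Y)} (hγ : ∀ i, γ.map (fun x => x i) = μ i)
    {c : (ι → Y) → ℝ} (hc : Integrable c γ)
    (h : ∀ ε > 0, ∃ f : ι → Y → ℝ, (∀ i, Integrable (f i) (μ i)) ∧ (∀ x, c x ≤ ∑ i, f i (x i)) ∧
        ∑ i, ∫ y, f i y ∂μ i ≤ ∫ x, c x ∂γ + ε) :
    ∃ f : ℕ → ι → Y → ℝ, (∀ n x, c x ≤ ∑ i, f n i (x i)) ∧
      ∀ᵐ x ∂γ, Tendsto (fun n => ∑ i, f n i (x i)) atTop (𝓝 (c x)) := by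
  -- Summable errors make the series of excesses integrable, hence a.e. finite, so the whole
  -- sequence converges.
  choose f hf hfc hfe using fun n : ℕ => h ((1 / 2) ^ n) (by positivity)
  refine ⟨f, hfc, ?_⟩
  let F : ℕ → (ι → Y) → ℝ := fun n x => ∑ i, f n i (x i) - c x
  have hFi : ∀ n, Integrable (F n) γ := fun n => (integral_sum_apply hγ (hf n)).1.sub hc
  have hF0 : ∀ n x, 0 ≤ F n x := fun n x => sub_nonneg.2 (hfc n x)
  have hFint : ∀ n, ∫⁻ x, ENNReal.ofReal (F n x) ∂γ ≤ ENNReal.ofReal ((1 / 2) ^ n) := by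
    intro n
    rw [← ofReal_integral_eq_lintegral_ofReal (hFi n) (.of_forall (hF0 n))]
    refine ENNReal.ofReal_le_ofReal ?_
    have := integral_sum_apply hγ (hf n)
    simp only [F]
    rw [integral_sub this.1 hc, this.2]
    linarith [hfe n]
  have hsum : ∫⁻ x, ∑' n, ENNReal.ofReal (F n x) ∂γ ≠ ⊤ := by
    rw [lintegral_tsum fun n => (hFi n).aestronglyMeasurable.aemeasurable.ennreal_ofReal]
    refine ne_top_of_le_ne_top ?_ (ENNReal.tsum_le_tsum hFint)
    rw [← ENNReal.ofReal_tsum_of_nonneg (fun n => by positivity) summable_geometric_two]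
    exact ENNReal.ofReal_ne_top
  have hae := ae_lt_top' (AEMeasurable.tsum fun n =>
    (hFi n).aestronglyMeasurable.aemeasurable.ennreal_ofReal) hsum
  filter_upwards [hae] with x hx
  have h1 := ENNReal.tendsto_atTop_zero_of_tsum_ne_top hx.ne
  have h2 := (ENNReal.tendsto_toReal ENNReal.zero_ne_top).comp h1
  have h3 : Tendsto (fun n => F n x) atTop (𝓝 0) := by
    refine h2.congr fun n => ?_
    simp [ENNReal.toReal_ofReal (hF0 n x)]
  simpa [F] using h3.add_const (c x)

/-- Attainment of the dual problem, without regularity of the potentials. -/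
theorem exists_potentials {γ : Measure (ι → Y)} [NeZero γ] {c : (ι → Y) → ℝ}
    {f : ℕ → ι → Y → ℝ} (hfc : ∀ n x, c x ≤ ∑ i, f n i (x i))
    (hft : ∀ᵐ x ∂γ, Tendsto (fun n => ∑ i, f n i (x i)) atTop (𝓝 (c x))) :
    ∃ φ : ι → Y → EReal, (∀ i y, φ i y ≠ ⊥) ∧ (∀ x, (c x : EReal) ≤ ∑ i, φ i (x i)) ∧
      ∀ᵐ x ∂γ, ∑ i, φ i (x i) = (c x : EReal) := by
  classical
  obtain ⟨z, hz⟩ := hft.exists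
  -- The shifts give all potentials the common value `s n` at the coordinates of `z` and cancel in
  -- the sum; `s` converges because `z` is a point of convergence.
  let s : ℕ → ℝ := fun n => (Fintype.card ι : ℝ)⁻¹ * ∑ j, f n j (z j)
  let g : ℕ → ι → Y → ℝ := fun n i y => f n i y - f n i (z i) + s n
  have hgf : ∀ n (x : ι → Y), ∑ i, g n i (x i) = ∑ i, f n i (x i) := by
    intro n x
    cases isEmpty_or_nonempty ι
    · simp
    have : (Fintype.card ι : ℝ) ≠ 0 := Nat.cast_ne_zero.2 Fintype.card_ne_zero
    simp only [g, s, Finset.sum_add_distrib, Finset.sum_sub_distrib, Finset.sum_const,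
      Finset.card_univ, nsmul_eq_mul, mul_inv_cancel_left₀ this]
    ring
  have hs : Tendsto s atTop (𝓝 ((Fintype.card ι : ℝ)⁻¹ * c z)) := hz.const_mul _
  let U : Ultrafilter ℕ := hyperfilter ℕ
  have hU : (U : Filter ℕ) ≤ atTop := Nat.hyperfilter_le_atTop
  -- Compactness of `EReal` gives all these pointwise limits at once, at the price of measurability.
  let φ : ι → Y → EReal := fun i y => (U.map fun n => (g n i y : EReal)).lim
  have hφ : ∀ i y, Tendsto (fun n => (g n i y : EReal)) U (𝓝 (φ i y)) := fun i y =>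
    (U.map fun n => (g n i y : EReal)).le_nhds_lim
  have hbot : ∀ i y, φ i y ≠ ⊥ := by
    intro i y
    -- With all coordinates but the `i`-th kept at `z`, the other summands equal `s n`, and the
    -- constraint bounds `g n i y` below by a convergent sequence.
    have hlow : ∀ n, c (Function.update z i y) - ((Fintype.card ι - 1 : ℕ) : ℝ) * s n ≤
        g n i y := by
      intro n
      have h1 := hfc n (Function.update z i y)
      rw [← hgf, ← Finset.add_sum_erase _ _ (Finset.mem_univ i), Function.update_self] at h1
      have h2 : ∑ j ∈ Finset.univ.erase i, g n j (Function.update z i y j) =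
          ((Fintype.card ι - 1 : ℕ) : ℝ) * s n := by
        rw [Finset.sum_congr rfl (g := fun _ => s n), Finset.sum_const,
          Finset.card_erase_of_mem (Finset.mem_univ i), Finset.card_univ, nsmul_eq_mul]
        intro j hj
        rw [Function.update_of_ne (Finset.ne_of_mem_erase hj)]
        simp [g]
      linarith
    have h3 := ((hs.const_mul ((Fintype.card ι - 1 : ℕ) : ℝ)).const_sub
      (c (Function.update z i y))).mono_left hU
    have h4 := le_of_tendsto_of_tendsto' ((continuous_coe_real_ereal.tendsto _).comp h3) (hφ i y)
      fun n => EReal.coe_le_coe_iff.2 (hlow n)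
    exact ne_bot_of_le_ne_bot (EReal.coe_ne_bot _) h4
  have hlim : ∀ x : ι → Y, Tendsto (fun n => ((∑ i, f n i (x i) : ℝ) : EReal)) U
      (𝓝 (∑ i, φ i (x i))) := by
    intro x
    refine (tendsto_ereal_sum (fun i _ => hbot i (x i)) fun i _ => hφ i (x i)).congr fun n => ?_
    rw [← ereal_coe_sum, hgf]
  refine ⟨φ, hbot, fun x => ge_of_tendsto' (hlim x) fun n => EReal.coe_le_coe_iff.2 (hfc n x), ?_⟩
  filter_upwards [hft] with x hx
  exact tendsto_nhds_unique (hlim x)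
    ((continuous_coe_real_ereal.tendsto _).comp (hx.mono_left hU))

end DualOptimizer

/-! ### Suprema of affine minorants -/

section AffineHull

variable {F : Type*} [NormedAddCommGroup F] [NormedSpace ℝ F]

/-- The supremum of the continuous affine minorants of `φ`. -/
noncomputable def affineHull (φ : F → EReal) (y : F) : EReal :=
  ⨆ l : {l : (F →L[ℝ] ℝ) × ℝ // ∀ z, ((l.1 z + l.2 : ℝ) : EReal) ≤ φ z},
    ((l.1.1 y + l.1.2 : ℝ) : EReal)

theorem affineHull_le (φ : F → EReal) (y : F) : affineHull φ y ≤ φ y := iSup_le fun l => l.2 y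

theorem le_affineHull {φ : F → EReal} {L : F →L[ℝ] ℝ} {b : ℝ}
    (h : ∀ z, ((L z + b : ℝ) : EReal) ≤ φ z) (y : F) : ((L y + b : ℝ) : EReal) ≤ affineHull φ y :=
  le_iSup (fun l : {l : (F →L[ℝ] ℝ) × ℝ // ∀ z, ((l.1 z + l.2 : ℝ) : EReal) ≤ φ z} =>
    ((l.1.1 y + l.1.2 : ℝ) : EReal)) ⟨(L, b), h⟩

theorem affineHull_ne_bot {φ : F → EReal} {L : F →L[ℝ] ℝ} {b : ℝ}
    (h : ∀ z, ((L z + b : ℝ) : EReal) ≤ φ z) (y : F) : affineHull φ y ≠ ⊥ :=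
  ne_bot_of_le_ne_bot (EReal.coe_ne_bot _) (le_affineHull h y)

theorem lowerSemicontinuous_affineHull (φ : F → EReal) : LowerSemicontinuous (affineHull φ) :=
  lowerSemicontinuous_iSup fun l => Continuous.lowerSemicontinuous
    (continuous_coe_real_ereal.comp (by fun_prop))

theorem affineHull_le_of_combo {φ : F → EReal} {x y : F} {s t u v : ℝ} (hs : 0 ≤ s) (ht : 0 ≤ t)
    (hst : s + t = 1) (hx : affineHull φ x ≤ u) (hy : affineHull φ y ≤ v) :
    affineHull φ (s • x + t • y) ≤ ((s * u + t * v : ℝ) : EReal) := by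
  refine iSup_le fun l => EReal.coe_le_coe_iff.2 ?_
  have h1 := EReal.coe_le_coe_iff.1 ((le_affineHull l.2 x).trans hx)
  have h2 := EReal.coe_le_coe_iff.1 ((le_affineHull l.2 y).trans hy)
  rw [map_add, map_smul, map_smul, smul_eq_mul, smul_eq_mul]
  calc s * l.1.1 x + t * l.1.1 y + l.1.2
      = s * l.1.1 x + t * l.1.1 y + (s + t) * l.1.2 := by rw [hst, one_mul]
    _ = s * (l.1.1 x + l.1.2) + t * (l.1.1 y + l.1.2) := by ring
    _ ≤ _ := add_le_add (mul_le_mul_of_nonneg_left h1 hs) (mul_le_mul_of_nonneg_left h2 ht)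

end AffineHull

/-! ### Growth of the determinant -/

section Determinant

variable {d : ℕ}

theorem continuous_detVec : Continuous (detVec : (Fin d → Vec d) → ℝ) := by
  unfold detVec
  refine Continuous.matrix_det ?_
  refine continuous_matrix fun k j => ?_
  simp only [Matrix.of_apply]
  fun_prop

theorem abs_detVec_le (x : Fin d → Vec d) : |detVec x| ≤ d.factorial * ∏ j, ‖x j‖ := by
  unfold detVec
  rw [Matrix.det_apply']
  refine (Finset.abs_sum_le_sum_abs _ _).trans ?_
  have h : ∀ σ ∈ (Finset.univ : Finset (Equiv.Perm (Fin d))),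
      |((Equiv.Perm.sign σ : ℤ) : ℝ) * ∏ i, Matrix.of (fun k j => x j k) (σ i) i| ≤
        ∏ j, ‖x j‖ := by
    intro σ _
    have hσ : |((Equiv.Perm.sign σ : ℤ) : ℝ)| = 1 := by
      rcases Int.units_eq_one_or (Equiv.Perm.sign σ) with h | h <;> simp [h]
    rw [abs_mul, hσ, one_mul, Finset.abs_prod]
    refine Finset.prod_le_prod (fun i _ => abs_nonneg _) fun i _ => ?_
    simpa using PiLp.norm_apply_le (x i) (σ i)
  refine (Finset.sum_le_card_nsmul _ _ _ h).trans ?_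
  simp [Fintype.card_perm]

theorem detVec_mem_dominated {p : Fin d → ℝ} (hp : ∀ i, 1 < p i) (hp_sum : ∑ i, 1 / p i = 1) :
    detVec ∈ dominated fun i (y : Vec d) => 1 + ‖y‖ ^ p i := by
  refine ⟨d.factorial, fun x => (abs_detVec_le x).trans ?_⟩
  refine mul_le_mul_of_nonneg_left ?_ (Nat.cast_nonneg _)
  have hp0 : ∀ i, 0 < p i := fun i => zero_lt_one.trans (hp i)
  have h := Real.geom_mean_le_arith_mean_weighted Finset.univ (fun i => 1 / p i)
    (fun i => ‖x i‖ ^ p i) (fun i _ => (one_div_pos.2 (hp0 i)).le) hp_sum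
    (fun i _ => Real.rpow_nonneg (norm_nonneg _) _)
  calc ∏ j, ‖x j‖ = ∏ i, (‖x i‖ ^ p i) ^ (1 / p i) := Finset.prod_congr rfl fun i _ => by
        rw [← Real.rpow_mul (norm_nonneg _), mul_one_div_cancel (hp0 i).ne', Real.rpow_one]
    _ ≤ _ := h
    _ ≤ _ := Finset.sum_le_sum fun i _ => by
        have h0 := Real.rpow_nonneg (norm_nonneg (x i)) (p i)
        have h1 : 1 / p i ≤ 1 := (div_le_one (hp0 i)).2 (hp i).le
        linarith [mul_le_of_le_one_left h0 h1]

theorem detVec_update_self (x : Fin d → Vec d) (i : Fin d) :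
    inner ℝ (signedWedge i x) (x i) = detVec x := by
  rw [inner_signedWedge, Function.update_eq_self]

end Determinant

/-! ### Convexifying the potentials -/

section Potentials

variable {d : ℕ} {φ : Fin d → Vec d → EReal}

/-- Each potential lies above the affine functions given by the other ones. -/
theorem affine_le_potential (hbot : ∀ i y, φ i y ≠ ⊥)
    (hle : ∀ x : Fin d → Vec d, (detVec x : EReal) ≤ ∑ i, φ i (x i)) (i : Fin d)
    {z : Fin d → Vec d} (hz : ∀ j ≠ i, φ j (z j) ≠ ⊤) (y : Vec d) :
    ((innerSL ℝ (signedWedge i z) y + -∑ j ∈ Finset.univ.erase i, (φ j (z j)).toReal : ℝ) :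
      EReal) ≤ φ i y := by
  have h := hle (Function.update z i y)
  rw [← inner_signedWedge, ← Finset.add_sum_erase _ _ (Finset.mem_univ i), Function.update_self]
    at h
  have h2 : ∑ j ∈ Finset.univ.erase i, φ j (Function.update z i y j) =
      ((∑ j ∈ Finset.univ.erase i, (φ j (z j)).toReal : ℝ) : EReal) := by
    rw [ereal_coe_sum]
    refine Finset.sum_congr rfl fun j hj => ?_
    have hji := Finset.ne_of_mem_erase hj
    rw [Function.update_of_ne hji, EReal.coe_toReal (hz j hji) (hbot j _)]
  rw [h2] at h
  rw [innerSL_apply_apply]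
  induction hy : φ i y with
  | bot => exact absurd hy (hbot i y)
  | top => exact le_top
  | coe r =>
    rw [hy, ← EReal.coe_add, EReal.coe_le_coe_iff] at h
    rw [EReal.coe_le_coe_iff]
    linarith

/-- For fixed other coordinates with finite potentials, the constraint is an affine minorant of `φ
i`, which the hull retains. The potentials are replaced one index at a time, the constraint being
re-read after each replacement. -/
theorem detVec_le_sum_affineHull (hbot : ∀ i y, φ i y ≠ ⊥)
    (hle : ∀ x : Fin d → Vec d, (detVec x : EReal) ≤ ∑ i, φ i (x i))
    {z : Fin d → Vec d} (hz : ∀ j, φ j (z j) ≠ ⊤) (x : Fin d → Vec d) :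
    (detVec x : EReal) ≤ ∑ i, affineHull (φ i) (x i) := by
  classical
  have hhull : ∀ i y, affineHull (φ i) y ≠ ⊥ := fun i =>
    affineHull_ne_bot (affine_le_potential hbot hle i fun j _ => hz j)
  have key : ∀ s : Finset (Fin d), ∀ x : Fin d → Vec d,
      (detVec x : EReal) ≤ ∑ i, (if i ∈ s then affineHull (φ i) else φ i) (x i) := by
    intro s
    induction s using Finset.induction_on with
    | empty => simpa using hle
    | insert i s hi ih =>
      intro x
      have hb : ∀ j y, (if j ∈ s then affineHull (φ j) else φ j) y ≠ ⊥ := by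
        intro j y
        split_ifs
        exacts [hhull j y, hbot j y]
      have hb' : ∀ j y, (if j ∈ insert i s then affineHull (φ j) else φ j) y ≠ ⊥ := by
        intro j y
        split_ifs
        exacts [hhull j y, hbot j y]
      have he : ∀ j ≠ i, (if j ∈ insert i s then affineHull (φ j) else φ j) =
          if j ∈ s then affineHull (φ j) else φ j := fun j hj => by
        simp [Finset.mem_insert, hj]
      by_cases htop : ∃ j ≠ i, (if j ∈ s then affineHull (φ j) else φ j) (x j) = ⊤
      · obtain ⟨j, hj, hjt⟩ := htop
        rw [ereal_sum_eq_top (fun k _ => hb' k (x k)) (Finset.mem_univ j) (by rw [he j hj, hjt])]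
        exact le_top
      · push Not at htop
        have h1 := affine_le_potential hb ih i (z := x) htop
        simp only [if_neg hi] at h1
        have h2 := le_affineHull h1 (x i)
        rw [← Finset.add_sum_erase _ _ (Finset.mem_univ i), if_pos (Finset.mem_insert_self i s)]
        have h3 : ∑ j ∈ Finset.univ.erase i,
            (if j ∈ insert i s then affineHull (φ j) else φ j) (x j) =
            ((∑ j ∈ Finset.univ.erase i,
              ((if j ∈ s then affineHull (φ j) else φ j) (x j)).toReal : ℝ) : EReal) := by
          rw [ereal_coe_sum]
          refine Finset.sum_congr rfl fun j hj => ?_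
          have hji := Finset.ne_of_mem_erase hj
          rw [he j hji, EReal.coe_toReal (htop j hji) (hb j _)]
        rw [h3]
        refine le_trans (le_of_eq ?_) (add_le_add_left h2 _)
        rw [← EReal.coe_add, innerSL_apply_apply, detVec_update_self]
        congr 1
        ring
  simpa using key Finset.univ x

end Potentials

/-! ### Weak duality and complementary slackness -/

section Cost

variable {d : ℕ} {μ : Fin d → Measure (Vec d)} {φ : Fin d → Vec d → EReal}

theorem IsDualAdmissible.measurable (hφ : IsDualAdmissible φ) (i : Fin d) : Measurable (φ i) :=
  (hφ.lsc i).measurable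

/-- Finiteness a.e. matters for the positive parts only: `toReal` sends `⊤` to `0`, which is already
its negative part. -/
theorem dualCost_eq_sum_integral (hfin : ∀ i, ∀ᵐ y ∂μ i, φ i y ≠ ⊤) (hbot : ∀ i y, φ i y ≠ ⊥)
    (hint : ∀ i, Integrable (fun y => (φ i y).toReal) (μ i)) :
    posCost μ φ ≠ ⊤ ∧ dualCost μ φ = ((∑ i, ∫ y, (φ i y).toReal ∂μ i : ℝ) : EReal) := by
  have hpos : ∀ i, ∫⁻ y, (φ i y).toENNReal ∂μ i =
      ∫⁻ y, ENNReal.ofReal (φ i y).toReal ∂μ i := fun i => by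
    refine lintegral_congr_ae ?_
    filter_upwards [hfin i] with y hy
    exact EReal.toENNReal_of_ne_top hy
  have hneg : ∀ i, ∫⁻ y, (-φ i y).toENNReal ∂μ i =
      ∫⁻ y, ENNReal.ofReal (-(φ i y).toReal) ∂μ i := fun i => by
    refine lintegral_congr_ae (.of_forall fun y => ?_)
    have h : -φ i y ≠ ⊤ := by simpa [EReal.neg_eq_top_iff] using hbot i y
    change (-φ i y).toENNReal = _
    rw [EReal.toENNReal_of_ne_top h, EReal.toReal_neg_eq]
  have hpos_ne : ∀ i, ∫⁻ y, ENNReal.ofReal (φ i y).toReal ∂μ i ≠ ⊤ := fun i =>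
    (hint i).lintegral_lt_top.ne
  have hneg_ne : ∀ i, ∫⁻ y, ENNReal.ofReal (-(φ i y).toReal) ∂μ i ≠ ⊤ := fun i =>
    (hint i).neg.lintegral_lt_top.ne
  have hp : posCost μ φ ≠ ⊤ := by
    unfold posCost
    simp only [hpos]
    exact ENNReal.sum_ne_top.2 fun i _ => hpos_ne i
  have hn : negCost μ φ ≠ ⊤ := by
    unfold negCost
    simp only [hneg]
    exact ENNReal.sum_ne_top.2 fun i _ => hneg_ne i
  refine ⟨hp, ?_⟩
  rw [dualCost, if_neg hp, ← EReal.coe_ennreal_toReal hp, ← EReal.coe_ennreal_toReal hn,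
    ← EReal.coe_sub]
  congr 1
  unfold posCost negCost
  simp only [hpos, hneg]
  rw [ENNReal.toReal_sum fun i _ => hpos_ne i, ENNReal.toReal_sum fun i _ => hneg_ne i,
    ← Finset.sum_sub_distrib]
  exact Finset.sum_congr rfl fun i _ =>
    (integral_eq_lintegral_pos_part_sub_lintegral_neg_part (hint i)).symm

/-- Freezing the other variables at `z` gives affine minorants, integrable by the first moments. -/
theorem exists_integrable_minorant [∀ i, IsProbabilityMeasure (μ i)]
    (hnorm : ∀ i, Integrable (fun y => ‖y‖) (μ i)) (hφ : IsDualAdmissible φ)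
    {z : Fin d → Vec d} (hz : ∀ i, φ i (z i) ≠ ⊤) :
    ∃ L : Fin d → Vec d → ℝ, (∀ i, Integrable (L i) (μ i)) ∧
      ∀ i y, φ i y ≠ ⊤ → L i y ≤ (φ i y).toReal := by
  refine ⟨fun i y => innerSL ℝ (signedWedge i z) y +
    -∑ j ∈ Finset.univ.erase i, (φ j (z j)).toReal, fun i => ?_, fun i y hy => ?_⟩
  · refine Integrable.add (Integrable.mono' ((hnorm i).const_mul ‖innerSL ℝ (signedWedge i z)‖)
      (by fun_prop) (.of_forall fun y => ?_)) (integrable_const _)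
    exact ContinuousLinearMap.le_opNorm _ y
  · have h := affine_le_potential hφ.ne_bot hφ.le_sum i (fun j _ => hz j) y
    rwa [← EReal.coe_toReal hy (hφ.ne_bot i y), EReal.coe_le_coe_iff] at h

theorem integrable_toReal_of_posCost_ne_top [∀ i, IsProbabilityMeasure (μ i)]
    (hnorm : ∀ i, Integrable (fun y => ‖y‖) (μ i)) (hφ : IsDualAdmissible φ)
    (h : posCost μ φ ≠ ⊤) :
    (∀ i, ∀ᵐ y ∂μ i, φ i y ≠ ⊤) ∧ ∀ i, Integrable (fun y => (φ i y).toReal) (μ i) := by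
  have hi : ∀ i, ∫⁻ y, (φ i y).toENNReal ∂μ i ≠ ⊤ := fun i =>
    ENNReal.sum_ne_top.1 h i (Finset.mem_univ i)
  have hfin : ∀ i, ∀ᵐ y ∂μ i, φ i y ≠ ⊤ := fun i => by
    filter_upwards [ae_lt_top (hφ.measurable i).ereal_toENNReal (hi i)] with y hy
    exact EReal.toENNReal_ne_top_iff.1 hy.ne
  refine ⟨hfin, fun i => ?_⟩
  choose z hz using fun i => (hfin i).exists
  obtain ⟨L, hL, hLφ⟩ := exists_integrable_minorant hnorm hφ hz
  have hU : Integrable (fun y => (φ i y).toENNReal.toReal) (μ i) :=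
    integrable_toReal_of_lintegral_ne_top (hφ.measurable i).ereal_toENNReal.aemeasurable (hi i)
  refine integrable_of_le_of_le (hφ.measurable i).ereal_toReal.aestronglyMeasurable
    ?_ ?_ (hL i) hU
  · filter_upwards [hfin i] with y hy using hLφ i y hy
  · filter_upwards [hfin i] with y hy
    rw [EReal.toENNReal_of_ne_top hy, ENNReal.toReal_ofReal']
    exact le_max_left _ _

variable {γ : Measure (Fin d → Vec d)}

theorem IsPlan.ae_eval (hγ : IsPlan μ γ) (i : Fin d) {q : Vec d → Prop} (h : ∀ᵐ y ∂μ i, q y) :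
    ∀ᵐ x ∂γ, q (x i) := by
  rw [← hγ i] at h
  exact ae_of_ae_map (measurable_pi_apply i).aemeasurable h

theorem IsPlan.ae_of_ae_eval (hγ : IsPlan μ γ) (i : Fin d) {q : Vec d → Prop}
    (hq : MeasurableSet {y | q y}) (h : ∀ᵐ x ∂γ, q (x i)) : ∀ᵐ y ∂μ i, q y := by
  rw [← hγ i]
  exact (ae_map_iff (measurable_pi_apply i).aemeasurable hq).2 h

theorem toReal_sum_eq {x : Fin d → Vec d} (hbot : ∀ i y, φ i y ≠ ⊥) (h : ∀ i, φ i (x i) ≠ ⊤) :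
    ∑ i, φ i (x i) = ((∑ i, (φ i (x i)).toReal : ℝ) : EReal) := by
  rw [ereal_coe_sum]
  exact Finset.sum_congr rfl fun i _ => (EReal.coe_toReal (h i) (hbot i _)).symm

theorem ne_top_of_sum_eq_coe {x : Fin d → Vec d} (hbot : ∀ i y, φ i y ≠ ⊥) {r : ℝ}
    (h : ∑ i, φ i (x i) = r) (i : Fin d) : φ i (x i) ≠ ⊤ := fun ht =>
  EReal.coe_ne_top r (h.symm.trans (ereal_sum_eq_top (fun j _ => hbot j _) (Finset.mem_univ i) ht))

/-- Weak duality. -/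
theorem integral_detVec_le_dualCost [∀ i, IsProbabilityMeasure (μ i)]
    (hnorm : ∀ i, Integrable (fun y => ‖y‖) (μ i)) (hγ : IsPlan μ γ) (hdet : Integrable detVec γ)
    (hφ : IsDualAdmissible φ) : ((∫ x, detVec x ∂γ : ℝ) : EReal) ≤ dualCost μ φ := by
  by_cases h : posCost μ φ = ⊤
  · rw [dualCost, if_pos h]
    exact le_top
  obtain ⟨hfin, hint⟩ := integrable_toReal_of_posCost_ne_top hnorm hφ h
  rw [(dualCost_eq_sum_integral hfin hφ.ne_bot hint).2, EReal.coe_le_coe_iff]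
  have hs := integral_sum_apply hγ hint
  rw [← hs.2]
  refine integral_mono_ae hdet hs.1 ?_
  filter_upwards [ae_all_iff.2 fun i => hγ.ae_eval i (hfin i)] with x hx
  have := hφ.le_sum x
  rwa [toReal_sum_eq hφ.ne_bot hx, EReal.coe_le_coe_iff] at this

/-- Complementary slackness. -/
theorem dualCost_eq_integral_iff [∀ i, IsProbabilityMeasure (μ i)] [IsProbabilityMeasure γ]
    (hnorm : ∀ i, Integrable (fun y => ‖y‖) (μ i)) (hγ : IsPlan μ γ) (hdet : Integrable detVec γ)
    (hφ : IsDualAdmissible φ) :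
    dualCost μ φ = ((∫ x, detVec x ∂γ : ℝ) : EReal) ↔
      ∀ᵐ x ∂γ, ∑ i, φ i (x i) = (detVec x : EReal) := by
  constructor
  · intro h
    have hp : posCost μ φ ≠ ⊤ := by
      intro hp
      rw [dualCost, if_pos hp] at h
      exact EReal.coe_ne_top _ h.symm
    obtain ⟨hfin, hint⟩ := integrable_toReal_of_posCost_ne_top hnorm hφ hp
    rw [(dualCost_eq_sum_integral hfin hφ.ne_bot hint).2, EReal.coe_eq_coe_iff] at h
    have hs := integral_sum_apply hγ hint
    rw [← hs.2] at h
    have hx := ae_all_iff.2 fun i => hγ.ae_eval i (hfin i)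
    have hle : detVec ≤ᵐ[γ] fun x => ∑ i, (φ i (x i)).toReal := by
      filter_upwards [hx] with x hx
      have := hφ.le_sum x
      rwa [toReal_sum_eq hφ.ne_bot hx, EReal.coe_le_coe_iff] at this
    filter_upwards [hx, (integral_eq_iff_of_ae_le hdet hs.1 hle).1 h.symm] with x hx he
    rw [toReal_sum_eq hφ.ne_bot hx, he]
  · intro h
    have hx : ∀ᵐ x ∂γ, ∀ i, φ i (x i) ≠ ⊤ := by
      filter_upwards [h] with x hx i using ne_top_of_sum_eq_coe hφ.ne_bot hx i
    have hfin : ∀ i, ∀ᵐ y ∂μ i, φ i y ≠ ⊤ := fun i => by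
      refine hγ.ae_of_ae_eval i ?_ (hx.mono fun x hx => hx i)
      exact ((hφ.measurable i) (measurableSet_singleton ⊤)).compl
    obtain ⟨z, hz⟩ := hx.exists
    obtain ⟨L, hL, hLφ⟩ := exists_integrable_minorant hnorm hφ hz
    have hLγ : ∀ i, Integrable (fun x : Fin d → Vec d => L i (x i)) γ := fun i => by
      have := hL i
      rw [← hγ i] at this
      exact this.comp_measurable (measurable_pi_apply i)
    have hreal : ∀ᵐ x ∂γ, ∑ i, (φ i (x i)).toReal = detVec x := by
      filter_upwards [h, hx] with x h1 h2
      rwa [toReal_sum_eq hφ.ne_bot h2, EReal.coe_eq_coe_iff] at h1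
    have hint : ∀ i, Integrable (fun y => (φ i y).toReal) (μ i) := fun i => by
      have hm : Measurable fun y => (φ i y).toReal := (hφ.measurable i).ereal_toReal
      rw [← hγ i, integrable_map_measure hm.aestronglyMeasurable
        (measurable_pi_apply i).aemeasurable]
      -- Tightness squeezes `φ i (x i)` between its own minorant and the determinant minus the other
      -- minorants, so finiteness of the cost need not be assumed.
      refine integrable_of_le_of_le (hm.comp (measurable_pi_apply i)).aestronglyMeasurable
        (g₁ := fun x => L i (x i))
        (g₂ := fun x => detVec x - ∑ j ∈ Finset.univ.erase i, L j (x j)) ?_ ?_ (hLγ i)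
        (hdet.sub (integrable_finsetSum _ fun j _ => hLγ j))
      · filter_upwards [hx] with x hx using hLφ i _ (hx i)
      · filter_upwards [hx, hreal] with x hx hr
        rw [← Finset.add_sum_erase _ _ (Finset.mem_univ i)] at hr
        have := Finset.sum_le_sum fun j (_ : j ∈ Finset.univ.erase i) => hLφ j _ (hx j)
        simp only [Function.comp_apply]
        linarith
    rw [(dualCost_eq_sum_integral hfin hφ.ne_bot hint).2, EReal.coe_eq_coe_iff,
      ← (integral_sum_apply hγ hint).2]
    exact integral_congr_ae hreal

end Cost

/-! ### Locally Lipschitz functions with zero gradient -/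

section LocallyLipschitz

variable {E : Type*} [NormedAddCommGroup E] [NormedSpace ℝ E] [FiniteDimensional ℝ E]
  [MeasurableSpace E] [BorelSpace E] {ν : Measure E} [ν.IsAddHaarMeasure] {f : E → ℝ}

/-- Rademacher's theorem on balls of integer radius; every point is interior to one of them. -/
theorem ae_differentiableAt_of_locallyLipschitz (hf : LocallyLipschitz f) :
    ∀ᵐ x ∂ν, DifferentiableAt ℝ f x := by
  have h : ∀ n : ℕ, ∀ᵐ x ∂ν, x ∈ Metric.closedBall (0 : E) n →
      DifferentiableWithinAt ℝ f (Metric.closedBall 0 n) x := fun n => by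
    obtain ⟨K, hK⟩ := hf.locallyLipschitzOn.exists_lipschitzOnWith_of_compact
      (isCompact_closedBall (0 : E) n)
    exact hK.ae_differentiableWithinAt_of_mem
  filter_upwards [ae_all_iff.2 h] with x hx
  obtain ⟨n, hn⟩ := exists_nat_gt ‖x‖
  have hxn : Metric.closedBall (0 : E) n ∈ 𝓝 x :=
    Metric.closedBall_mem_nhds_of_mem (by simpa using hn)
  exact (hx n (mem_of_mem_nhds hxn)).differentiableAt hxn

-- On a segment the function is absolutely continuous, so an a.e. zero derivative makes it constant.
omit [FiniteDimensional ℝ E] [MeasurableSpace E] [BorelSpace E] in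
theorem eq_of_ae_hasFDerivAt_zero_segment (hf : LocallyLipschitz f) {x v : E}
    (h : ∀ᵐ t : ℝ, HasFDerivAt f (0 : E →L[ℝ] ℝ) (x + t • v)) : f (x + v) = f x := by
  have hlip : LocallyLipschitz fun t : ℝ => f (x + t • v) := by
    refine hf.comp (f := f) (g := fun t : ℝ => x + t • v) ?_
    refine LipschitzWith.locallyLipschitz (K := ‖v‖₊) (LipschitzWith.of_dist_le_mul fun s t => ?_)
    rw [dist_add_left, dist_eq_norm, ← sub_smul, norm_smul, mul_comm, dist_eq_norm, coe_nnnorm]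
  obtain ⟨K, hK⟩ := hlip.locallyLipschitzOn.exists_lipschitzOnWith_of_compact
    (isCompact_uIcc (a := (0 : ℝ)) (b := 1))
  obtain ⟨C, hC⟩ := hK.absolutelyContinuousOnInterval.const_of_ae_hasDerivAt_zero (by
    filter_upwards [h] with t ht _
    have h1 : HasDerivAt (fun t : ℝ => x + t • v) v t := by
      simpa using ((hasDerivAt_id t).smul_const v).const_add x
    simpa [Function.comp_def] using ht.comp_hasDerivAt t h1)
  have h0 := hC 0 left_mem_uIcc
  have h1 := hC 1 right_mem_uIcc
  simp only [zero_smul, add_zero, one_smul] at h0 h1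
  rw [h0, h1]

/-- A locally Lipschitz function with almost everywhere vanishing derivative is constant. -/
theorem eq_of_ae_hasFDerivAt_zero (hf : LocallyLipschitz f)
    (h : ∀ᵐ x ∂ν, HasFDerivAt f (0 : E →L[ℝ] ℝ) x) (x y : E) : f x = f y := by
  have key : ∀ v x, f (x + v) = f x := by
    intro v
    -- A measurable conull set is needed for Fubini: for a.e. `x`, almost all points of the line
    -- through `x` along `v` lie in `T`.
    obtain ⟨T, hT, hTm, hT0⟩ : ∃ T ⊆ {x | HasFDerivAt f (0 : E →L[ℝ] ℝ) x},
        MeasurableSet T ∧ ν Tᶜ = 0 := by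
      obtain ⟨S, hS, hSm, hS0⟩ := exists_measurable_superset_of_null (ae_iff.1 h)
      exact ⟨Sᶜ, fun x hx => by_contra fun hx' => hx (hS hx'), hSm.compl, by rwa [compl_compl]⟩
    have hTae : ∀ᵐ x ∂ν, x ∈ T := hT0
    have h1 : ∀ᵐ t : ℝ, ∀ᵐ x ∂ν, x + t • v ∈ T := .of_forall fun t =>
      (measurePreserving_add_right ν (t • v)).quasiMeasurePreserving.ae hTae
    have hm : MeasurableSet {q : ℝ × E | q.2 + q.1 • v ∈ T} :=
      (show Measurable fun q : ℝ × E => q.2 + q.1 • v by fun_prop) hTm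
    have h2 := (Measure.ae_ae_comm hm).1 h1
    have h3 : ∀ᵐ x ∂ν, f (x + v) = f x := by
      filter_upwards [h2] with x hx
      exact eq_of_ae_hasFDerivAt_zero_segment hf (hx.mono fun t ht => hT ht)
    have h4 : (fun x => f (x + v)) = f := Continuous.ae_eq_iff_eq ν
      (hf.continuous.comp (by fun_prop)) hf.continuous |>.1 h3
    exact fun x => congrFun h4 x
  simpa using key (x - y) y

end LocallyLipschitz

/-! ### Finiteness and convexity of tight potentials -/

section Regularity

variable {d : ℕ} {μ : Fin d → Measure (Vec d)} {φ : Fin d → Vec d → EReal}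
  {γ : Measure (Fin d → Vec d)}

/-- The reflection `y ↦ 2x - y` preserves the measure, so `x` is the midpoint of two points where
the hull is finite; convexity concludes. -/
theorem affineHull_ne_top_of_ae {F : Type*} [NormedAddCommGroup F] [NormedSpace ℝ F]
    [FiniteDimensional ℝ F] [MeasurableSpace F] [BorelSpace F] {ν : Measure F}
    [ν.IsAddHaarMeasure] {u : F → EReal} (h : ∀ᵐ y ∂ν, affineHull u y ≠ ⊤) (x : F) :
    affineHull u x ≠ ⊤ := by
  have h2 := (Measure.measurePreserving_sub_left ν ((2 : ℝ) • x)).quasiMeasurePreserving.ae h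
  obtain ⟨y, hy, hy'⟩ := (h.and h2).exists
  have h3 := affineHull_le_of_combo (s := 1 / 2) (t := 1 / 2) (by norm_num) (by norm_num)
    (by norm_num) (EReal.le_coe_toReal hy) (EReal.le_coe_toReal hy')
  have e : (1 / 2 : ℝ) • y + (1 / 2 : ℝ) • ((2 : ℝ) • x - y) = x := by
    rw [smul_sub, smul_smul]
    norm_num
  rw [e] at h3
  exact ne_top_of_le_ne_top (EReal.coe_ne_top _) h3

theorem convexOn_toReal_affineHull {F : Type*} [NormedAddCommGroup F] [NormedSpace ℝ F]
    {u : F → EReal} (htop : ∀ y, affineHull u y ≠ ⊤) (hbot : ∀ y, affineHull u y ≠ ⊥) :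
    ConvexOn ℝ univ fun y => (affineHull u y).toReal := by
  refine ⟨convex_univ, fun x _ y _ s t hs ht hst => ?_⟩
  have h := affineHull_le_of_combo hs ht hst (EReal.le_coe_toReal (htop x))
    (EReal.le_coe_toReal (htop y))
  rw [← EReal.coe_toReal (htop _) (hbot _), EReal.coe_le_coe_iff] at h
  exact h

theorem affineHull_potential_ne_top (hvol : ∀ i, volume ≪ μ i) (hγ : IsPlan μ γ)
    (hbot : ∀ i y, φ i y ≠ ⊥) (heq : ∀ᵐ x ∂γ, ∑ i, φ i (x i) = (detVec x : EReal))
    (i : Fin d) (y : Vec d) : affineHull (φ i) y ≠ ⊤ := by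
  refine affineHull_ne_top_of_ae (ν := volume) ((hvol i).ae_le ?_) y
  refine hγ.ae_of_ae_eval i ?_ ?_
  · exact ((lowerSemicontinuous_affineHull (φ i)).measurable (measurableSet_singleton ⊤)).compl
  · filter_upwards [heq] with x hx
    exact ne_top_of_le_ne_top (ne_top_of_sum_eq_coe hbot hx i) (affineHull_le _ _)

theorem affineHull_potential_ne_bot [NeZero γ] (hbot : ∀ i y, φ i y ≠ ⊥)
    (hle : ∀ x : Fin d → Vec d, (detVec x : EReal) ≤ ∑ i, φ i (x i))
    (heq : ∀ᵐ x ∂γ, ∑ i, φ i (x i) = (detVec x : EReal))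
    (i : Fin d) (y : Vec d) : affineHull (φ i) y ≠ ⊥ := by
  obtain ⟨z, hz⟩ := heq.exists
  exact affineHull_ne_bot
    (affine_le_potential hbot hle i fun j _ => ne_top_of_sum_eq_coe hbot hz j) y

/-- The tuple of affine hulls is admissible and tight wherever the original one is. -/
theorem isDualAdmissible_affineHull [NeZero γ] (hbot : ∀ i y, φ i y ≠ ⊥)
    (hle : ∀ x : Fin d → Vec d, (detVec x : EReal) ≤ ∑ i, φ i (x i))
    (heq : ∀ᵐ x ∂γ, ∑ i, φ i (x i) = (detVec x : EReal)) :
    IsDualAdmissible (fun i => affineHull (φ i)) ∧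
      ∀ᵐ x ∂γ, ∑ i, affineHull (φ i) (x i) = (detVec x : EReal) := by
  obtain ⟨z, hz⟩ := heq.exists
  have hle' := detVec_le_sum_affineHull hbot hle fun j => ne_top_of_sum_eq_coe hbot hz j
  refine ⟨⟨fun i => lowerSemicontinuous_affineHull (φ i),
    affineHull_potential_ne_bot hbot hle heq, hle'⟩, ?_⟩
  filter_upwards [heq] with x hx
  refine le_antisymm ?_ (hle' x)
  rw [← hx]
  exact Finset.sum_le_sum fun i _ => affineHull_le _ _

/-- A strict inequality `g y < u y` would persist near `y`, against density of the set of equality.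
-/
theorem le_of_lowerSemicontinuous_of_ae_eq {F : Type*} [TopologicalSpace F] [MeasurableSpace F]
    {ν : Measure F} [ν.IsOpenPosMeasure] {u : F → EReal} {g : F → ℝ} (hu : LowerSemicontinuous u)
    (hg : Continuous g) (h : ∀ᵐ y ∂ν, u y = g y) (y : F) : u y ≤ g y := by
  by_contra! hlt
  obtain ⟨c, hc1, hc2⟩ := exists_between hlt
  have h1 := hu y c hc2
  have h2 : ∀ᶠ z in 𝓝 y, (g z : EReal) < c :=
    ((continuous_coe_real_ereal.comp hg).tendsto y).eventually_lt_const hc1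
  obtain ⟨z, hz, hz'⟩ := (Measure.dense_of_ae h).inter_nhds_nonempty (h1.and h2)
  have hz1 : c < u z ∧ (g z : EReal) < c := hz'
  have hz2 : u z = g z := hz
  rw [hz2] at hz1
  exact lt_asymm hz1.1 hz1.2

/-- Tight admissible potentials are finite convex functions. -/
theorem IsDualAdmissible.exists_convexOn [NeZero γ] (hvol : ∀ i, volume ≪ μ i)
    (hγ : IsPlan μ γ) (hφ : IsDualAdmissible φ)
    (heq : ∀ᵐ x ∂γ, ∑ i, φ i (x i) = (detVec x : EReal)) :
    ∃ g : Fin d → Vec d → ℝ, (∀ i, ConvexOn ℝ univ (g i)) ∧ ∀ i y, φ i y = g i y := by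
  have htop := affineHull_potential_ne_top hvol hγ hφ.ne_bot heq
  have hbot := affineHull_potential_ne_bot hφ.ne_bot hφ.le_sum heq
  have hconv : ∀ i, ConvexOn ℝ univ fun y => (affineHull (φ i) y).toReal := fun i =>
    convexOn_toReal_affineHull (htop i) (hbot i)
  refine ⟨fun i y => (affineHull (φ i) y).toReal, hconv, fun i y => ?_⟩
  obtain ⟨-, heq'⟩ := isDualAdmissible_affineHull hφ.ne_bot hφ.le_sum heq
  have h1 : ∀ᵐ x ∂γ, φ i (x i) = affineHull (φ i) (x i) := by
    filter_upwards [heq, heq'] with x hx hx'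
    have ht := ne_top_of_sum_eq_coe hφ.ne_bot hx
    have hs := hx
    rw [toReal_sum_eq hφ.ne_bot ht, EReal.coe_eq_coe_iff] at hs
    rw [toReal_sum_eq hbot fun j => htop j _, EReal.coe_eq_coe_iff] at hx'
    -- Both sums equal the determinant and the terms are ordered, so they agree term by term.
    have h2 := (Finset.sum_eq_sum_iff_of_le fun j (_ : j ∈ Finset.univ) =>
      EReal.toReal_le_toReal (affineHull_le (φ j) (x j)) (hbot j _) (ht j)).1
      (hx'.trans hs.symm) i (Finset.mem_univ i)
    rw [← EReal.coe_toReal (ht i) (hφ.ne_bot i _), ← h2, EReal.coe_toReal (htop i _) (hbot i _)]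
  have h2 : ∀ᵐ y ∂μ i, φ i y = affineHull (φ i) y := hγ.ae_of_ae_eval i
    (measurableSet_eq_fun (hφ.measurable i) (lowerSemicontinuous_affineHull (φ i)).measurable) h1
  have h3 : ∀ᵐ y ∂(volume : Measure (Vec d)), φ i y = ((affineHull (φ i) y).toReal : ℝ) := by
    filter_upwards [(hvol i).ae_le h2] with y hy
    rw [hy, EReal.coe_toReal (htop i y) (hbot i y)]
  refine le_antisymm (le_of_lowerSemicontinuous_of_ae_eq (hφ.lsc i)
    (hconv i).locallyLipschitz.continuous h3 y) ?_
  change ((affineHull (φ i) y).toReal : EReal) ≤ _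
  rw [EReal.coe_toReal (htop i y) (hbot i y)]
  exact affineHull_le _ _

end Regularity

/-! ### Gradients, uniqueness and conditional laws -/

section Gradient

variable {d : ℕ} {μ : Fin d → Measure (Vec d)} {γ : Measure (Fin d → Vec d)}
  {g : Fin d → Vec d → ℝ}

/-- Varying only the `i`-th coordinate, the constraint is an affine minorant of `g i` that touches
it at `x i`. -/
theorem hasGradientAt_signedWedge {x : Fin d → Vec d}
    (hle : ∀ x : Fin d → Vec d, detVec x ≤ ∑ i, g i (x i)) (hx : ∑ i, g i (x i) = detVec x)
    {i : Fin d} (hd : DifferentiableAt ℝ (g i) (x i)) :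
    HasGradientAt (g i) (signedWedge i x) (x i) := by
  have hmin : IsLocalMin (fun y => g i y - innerSL ℝ (signedWedge i x) y) (x i) := by
    refine .of_forall fun y => ?_
    have h := hle (Function.update x i y)
    rw [← inner_signedWedge, ← Finset.add_sum_erase _ _ (Finset.mem_univ i),
      Function.update_self, Finset.sum_congr rfl (g := fun j => g j (x j)) fun j hj => by
        rw [Function.update_of_ne (Finset.ne_of_mem_erase hj)]] at h
    rw [← Finset.add_sum_erase _ _ (Finset.mem_univ i), ← detVec_update_self x i] at hx
    simp only [innerSL_apply_apply]
    linarith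
  have h0 := hmin.hasFDerivAt_eq_zero
    (hd.hasFDerivAt.sub (innerSL ℝ (signedWedge i x)).hasFDerivAt)
  have h1 := hd.hasFDerivAt
  rw [sub_eq_zero.1 h0] at h1
  exact h1

theorem ae_hasGradientAt (hac : ∀ i, μ i ≪ volume) (hγ : IsPlan μ γ)
    (hg : ∀ i, ConvexOn ℝ univ (g i)) (hle : ∀ x : Fin d → Vec d, detVec x ≤ ∑ i, g i (x i))
    (heq : ∀ᵐ x ∂γ, ∑ i, g i (x i) = detVec x) (i : Fin d) :
    ∀ᵐ x ∂γ, HasGradientAt (g i) (signedWedge i x) (x i) := by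
  have hd : ∀ᵐ y ∂μ i, DifferentiableAt ℝ (g i) y :=
    (hac i).ae_le (ae_differentiableAt_of_locallyLipschitz (hg i).locallyLipschitz)
  filter_upwards [heq, hγ.ae_eval i hd] with x hx hdx
  exact hasGradientAt_signedWedge hle hx hdx

/-- Both gradients equal the same wedge γ-a.e.; this passes to the marginal, then to Lebesgue
measure. -/
theorem sub_eq_sub_of_ae_eq (hac : ∀ i, μ i ≪ volume) (hvol : ∀ i, volume ≪ μ i)
    (hγ : IsPlan μ γ) {h : Fin d → Vec d → ℝ}
    (hg : ∀ i, ConvexOn ℝ univ (g i)) (hgle : ∀ x : Fin d → Vec d, detVec x ≤ ∑ i, g i (x i))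
    (hgeq : ∀ᵐ x ∂γ, ∑ i, g i (x i) = detVec x)
    (hh : ∀ i, ConvexOn ℝ univ (h i)) (hhle : ∀ x : Fin d → Vec d, detVec x ≤ ∑ i, h i (x i))
    (hheq : ∀ᵐ x ∂γ, ∑ i, h i (x i) = detVec x) (i : Fin d) (y z : Vec d) :
    h i y - g i y = h i z - g i z := by
  have hlip : LocallyLipschitz fun y => h i y - g i y :=
    (hh i).locallyLipschitz.sub (hg i).locallyLipschitz
  refine eq_of_ae_hasFDerivAt_zero (ν := volume) hlip ((hvol i).ae_le ?_) y z
  have h1 : ∀ᵐ x ∂γ, fderiv ℝ (g i) (x i) = fderiv ℝ (h i) (x i) := by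
    filter_upwards [ae_hasGradientAt hac hγ hg hgle hgeq i,
      ae_hasGradientAt hac hγ hh hhle hheq i] with x hx hx'
    rw [hx.hasFDerivAt.fderiv, hx'.hasFDerivAt.fderiv]
  have h2 : ∀ᵐ y ∂μ i, fderiv ℝ (g i) y = fderiv ℝ (h i) y :=
    hγ.ae_of_ae_eval i (measurableSet_eq_fun (measurable_fderiv ℝ _) (measurable_fderiv ℝ _)) h1
  filter_upwards [h2, (hac i).ae_le (ae_differentiableAt_of_locallyLipschitz
    (hg i).locallyLipschitz), (hac i).ae_le (ae_differentiableAt_of_locallyLipschitz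
    (hh i).locallyLipschitz)] with y hy hy1 hy2
  have := hy2.hasFDerivAt.sub hy1.hasFDerivAt
  rwa [hy, sub_self] at this

/-- The law of `(x i, x)` is carried by the pairs whose second entry has the first as `i`-th
coordinate; disintegrating it gives both claims. -/
theorem ae_condDistrib_eval [IsFiniteMeasure γ] (i : Fin d)
    {q : (Fin d → Vec d) → Prop} (hq : ∀ᵐ x ∂γ, q x) :
    ∀ᵐ a ∂(γ.map fun x => x i),
      ∀ᵐ x ∂(condDistrib (fun x => x) (fun x : Fin d → Vec d => x i) γ a), x i = a ∧ q x := by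
  obtain ⟨S, hS, hSm, hS0⟩ := exists_measurable_superset_of_null (ae_iff.1 hq)
  have hm : MeasurableSet {r : Vec d × (Fin d → Vec d) | r.2 i = r.1 ∧ r.2 ∈ Sᶜ} :=
    (measurableSet_eq_fun (by fun_prop) (by fun_prop)).inter (measurable_snd hSm.compl)
  have h1 : ∀ᵐ r ∂(γ.map fun x => (x i, x)), r.2 i = r.1 ∧ r.2 ∈ Sᶜ := by
    rw [ae_map_iff (by fun_prop) hm]
    have : ∀ᵐ x ∂γ, x ∈ Sᶜ := by
      rw [ae_iff]
      simpa using hS0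
    filter_upwards [this] with x hx using ⟨rfl, hx⟩
  have h2 : (γ.map fun x => x i) ⊗ₘ condDistrib (fun x => x) (fun x => x i) γ =
      γ.map fun x => (x i, x) := compProd_map_condDistrib measurable_id.aemeasurable
  rw [← h2] at h1
  filter_upwards [Measure.ae_ae_of_ae_compProd h1] with a ha
  filter_upwards [ha] with x hx
  exact ⟨hx.1, by_contra fun hx' => hx.2 (hS hx')⟩

/-- Uniqueness of the gradient at `a` makes the wedge a.s. constant under the conditional law, hence
integrable and equal to its mean. -/
theorem ae_hasGradientAt_integral [IsFiniteMeasure γ] (hγ : IsPlan μ γ) {i : Fin d}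
    {u : Vec d → ℝ} (h : ∀ᵐ x ∂γ, HasGradientAt u (signedWedge i x) (x i)) :
    ∀ᵐ a ∂μ i, Integrable (signedWedge i) (condDistrib (fun x => x) (fun x => x i) γ a) ∧
      HasGradientAt u
        (∫ x, signedWedge i x ∂(condDistrib (fun x => x) (fun x => x i) γ a)) a := by
  have h1 := ae_condDistrib_eval i h
  rw [hγ i] at h1
  filter_upwards [h1] with a ha
  obtain ⟨z, hza, hz⟩ := ha.exists
  rw [hza] at hz
  have hc : signedWedge i =ᵐ[condDistrib (fun x => x) (fun x => x i) γ a]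
      fun _ => signedWedge i z := by
    filter_upwards [ha] with x hx
    have hx2 := hx.2
    rw [hx.1] at hx2
    exact hx2.unique hz
  refine ⟨(integrable_const _).congr hc.symm, ?_⟩
  rw [integral_congr_ae hc, integral_const, probReal_univ, one_smul]
  exact hz

end Gradient

/-! ### Assembling the duality statement -/

section Main

theorem detVec_le_sum_of_coe {d : ℕ} {φ : Fin d → Vec d → EReal} {g : Fin d → Vec d → ℝ}
    (hφ : IsDualAdmissible φ) (hg : ∀ i y, φ i y = g i y) (x : Fin d → Vec d) :
    detVec x ≤ ∑ i, g i (x i) := by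
  have h := hφ.le_sum x
  simp only [hg] at h
  rwa [← ereal_coe_sum, EReal.coe_le_coe_iff] at h

theorem ae_sum_eq_of_coe {d : ℕ} {φ : Fin d → Vec d → EReal} {g : Fin d → Vec d → ℝ}
    {γ : Measure (Fin d → Vec d)} (heq : ∀ᵐ x ∂γ, ∑ i, φ i (x i) = (detVec x : EReal))
    (hg : ∀ i y, φ i y = g i y) : ∀ᵐ x ∂γ, ∑ i, g i (x i) = detVec x := by
  filter_upwards [heq] with x hx
  simp only [hg] at hx
  rwa [← ereal_coe_sum, EReal.coe_eq_coe_iff] at hx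

/-- A positive density makes `ρ` absolutely continuous with respect to the part of `ν` having that
density, which is at most `ν`. -/
theorem absolutelyContinuous_of_rnDeriv_pos {α : Type*} [MeasurableSpace α]
    {ν ρ : Measure α} (h : ∀ᵐ x ∂ρ, 0 < ν.rnDeriv ρ x) : ρ ≪ ν :=
  (withDensity_absolutelyContinuous' (Measure.measurable_rnDeriv ν ρ).aemeasurable
    (h.mono fun _ hx => hx.ne')).trans
      (Measure.absolutelyContinuous_of_le (Measure.withDensity_rnDeriv_le ν ρ))

theorem integrable_norm_of_moment {d : ℕ} {ν : Measure (Vec d)} [IsProbabilityMeasure ν] {q : ℝ}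
    (hq : 1 < q) (h : Integrable (fun y => ‖y‖ ^ q) ν) : Integrable (fun y => ‖y‖) ν := by
  refine ((integrable_const (1 : ℝ)).add h).mono' (by fun_prop) (.of_forall fun y => ?_)
  rw [norm_norm, Pi.add_apply]
  rcases le_total ‖y‖ 1 with hy | hy
  · linarith [Real.rpow_nonneg (norm_nonneg y) q]
  · linarith [Real.self_le_rpow_of_one_le hy hq.le]

variable {d : ℕ} {μ : Fin d → Measure (Vec d)} [∀ i, IsProbabilityMeasure (μ i)] {p : Fin d → ℝ}

theorem integrable_detVec (hp : ∀ i, 1 < p i) (hp_sum : ∑ i, 1 / p i = 1)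
    (hmoment : ∀ i, Integrable (fun x => ‖x‖ ^ p i) (μ i)) {γ : Measure (Fin d → Vec d)}
    (hγ : IsPlan μ γ) : Integrable detVec γ := by
  obtain ⟨C, hC⟩ := detVec_mem_dominated hp hp_sum
  have h := (integral_sum_apply hγ (f := fun i (y : Vec d) => 1 + ‖y‖ ^ p i)
    fun i => (integrable_const (1 : ℝ)).add (hmoment i)).1
  exact (h.const_mul C).mono' continuous_detVec.aestronglyMeasurable (.of_forall hC)

theorem exists_plan_potentials (hp : ∀ i, 1 < p i) (hp_sum : ∑ i, 1 / p i = 1)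
    (hmoment : ∀ i, Integrable (fun x => ‖x‖ ^ p i) (μ i)) :
    ∃ γ : Measure (Fin d → Vec d), IsProbabilityMeasure γ ∧ IsPlan μ γ ∧
      ∃ φ : Fin d → Vec d → EReal, IsDualAdmissible φ ∧
        ∀ᵐ x ∂γ, ∑ i, φ i (x i) = (detVec x : EReal) := by
  have hne : Nonempty (Fin d) := by
    by_contra hne
    rw [not_nonempty_iff] at hne
    simp at hp_sum
  have hp0 : ∀ i, 0 < p i := fun i => zero_lt_one.trans (hp i)
  have hcont : ∀ i, Continuous fun y : Vec d => 1 + ‖y‖ ^ p i := fun i =>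
    continuous_const.add (continuous_norm.rpow_const fun _ => .inr (hp0 i).le)
  obtain ⟨γ, hγp, hγ, hf⟩ := exists_plan_forall_exists_majorant (μ := μ)
    (a := fun i (y : Vec d) => 1 + ‖y‖ ^ p i) hcont
    (fun i y => by linarith [Real.rpow_nonneg (norm_nonneg y) (p i)])
    (fun i R => by
      -- Truncating `R` at `0` keeps the base of the power nonnegative.
      refine (isCompact_closedBall (0 : Vec d) (max R 0 ^ (p i)⁻¹)).of_isClosed_subset
        (isClosed_le (hcont i) continuous_const) fun y hy => ?_
      have hy' : ‖y‖ ^ p i ≤ max R 0 := by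
        have h1 : 1 + ‖y‖ ^ p i ≤ R := hy
        exact le_max_of_le_left (by linarith)
      rw [mem_closedBall_zero_iff]
      exact (Real.le_rpow_inv_iff_of_pos (norm_nonneg y) (le_max_right _ _) (hp0 i)).2 hy')
    (fun i => (integrable_const (1 : ℝ)).add (hmoment i)) continuous_detVec
    (detVec_mem_dominated hp hp_sum)
  obtain ⟨f, hfc, hft⟩ := exists_seq_majorant_tendsto hγ
    (integrable_detVec hp hp_sum hmoment hγ) hf
  obtain ⟨φ, hbot, hle, heq⟩ := exists_potentials hfc hft
  exact ⟨γ, hγp, hγ, _, isDualAdmissible_affineHull hbot hle heq⟩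

/-- Given one tight pair, the dual solutions are the admissible tuples tight on that plan. -/
theorem isDualSolution_iff (hnorm : ∀ i, Integrable (fun y => ‖y‖) (μ i))
    {γ : Measure (Fin d → Vec d)} [IsProbabilityMeasure γ] (hγ : IsPlan μ γ)
    (hdet : Integrable detVec γ) {φ : Fin d → Vec d → EReal} (hφ : IsDualAdmissible φ)
    (heq : ∀ᵐ x ∂γ, ∑ i, φ i (x i) = (detVec x : EReal)) (ψ : Fin d → Vec d → EReal) :
    IsDualSolution μ ψ ↔ IsDualAdmissible ψ ∧
      ∀ᵐ x ∂γ, ∑ i, ψ i (x i) = (detVec x : EReal) := by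
  have hφc := (dualCost_eq_integral_iff hnorm hγ hdet hφ).2 heq
  constructor
  · rintro ⟨hψ, hmin⟩
    refine ⟨hψ, (dualCost_eq_integral_iff hnorm hγ hdet hψ).1 (le_antisymm ?_ ?_)⟩
    · exact (hmin φ hφ).trans hφc.le
    · exact integral_detVec_le_dualCost hnorm hγ hdet hψ
  · rintro ⟨hψ, hψe⟩
    refine ⟨hψ, fun χ hχ => ?_⟩
    rw [(dualCost_eq_integral_iff hnorm hγ hdet hψ).2 hψe]
    exact integral_detVec_le_dualCost hnorm hγ hdet hχ

end Main

end DetTransport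

theorem mainTheorem6 (d : ℕ) (μ : Fin d → Measure (DetTransport.Vec d))
    [hprob : ∀ i, IsProbabilityMeasure (μ i)]
    (p : Fin d → ℝ) (hp : ∀ i, 1 < p i) (hp_sum : ∑ i, 1 / p i = 1)
    (hmoment : ∀ i, Integrable (fun x => ‖x‖ ^ p i) (μ i))
    (hac : ∀ i, μ i ≪ volume)
    (hpos : ∀ i, ∀ᵐ x ∂(volume : Measure (DetTransport.Vec d)),
      0 < (μ i).rnDeriv volume x) :
    (∃ φ : Fin d → DetTransport.Vec d → EReal, DetTransport.IsDualSolution μ φ ∧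
      ∀ ψ : Fin d → DetTransport.Vec d → EReal, DetTransport.IsDualSolution μ ψ ↔
        ∃ c : Fin d → ℝ, ∑ i, c i = 0 ∧ ∀ i x, ψ i x = φ i x + (c i : EReal)) ∧
    (∀ φ : Fin d → DetTransport.Vec d → EReal, DetTransport.IsDualSolution μ φ →
      ∀ (γ : Measure (Fin d → DetTransport.Vec d)) [IsProbabilityMeasure γ],
        DetTransport.IsOptimalPlan μ γ →
        ∀ i, ∀ᵐ a ∂(μ i),
          (∀ᶠ b in 𝓝 a, φ i b ≠ ⊤) ∧
          Integrable (DetTransport.signedWedge i)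
            (condDistrib (fun x => x) (fun x => x i) γ a) ∧
          HasGradientAt (fun b => (φ i b).toReal)
            (∫ x, DetTransport.signedWedge i x
              ∂(condDistrib (fun x => x) (fun x => x i) γ a)) a) := by
  open DetTransport in
  have hvol : ∀ i, volume ≪ μ i := fun i => absolutelyContinuous_of_rnDeriv_pos (hpos i)
  have hnorm : ∀ i, Integrable (fun y => ‖y‖) (μ i) := fun i =>
    integrable_norm_of_moment (hp i) (hmoment i)
  have hdet : ∀ {γ}, IsPlan μ γ → Integrable detVec γ := integrable_detVec hp hp_sum hmoment
  obtain ⟨γ₀, hγ₀p, hγ₀, φ₀, hφ₀, heq₀⟩ := exists_plan_potentials hp hp_sum hmoment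
  have hiff := isDualSolution_iff hnorm hγ₀ (hdet hγ₀) hφ₀ heq₀
  obtain ⟨g₀, hg₀, hφg₀⟩ := hφ₀.exists_convexOn hvol hγ₀ heq₀
  have hle₀ := detVec_le_sum_of_coe hφ₀ hφg₀
  have hge₀ := ae_sum_eq_of_coe heq₀ hφg₀
  refine ⟨⟨φ₀, (hiff φ₀).2 ⟨hφ₀, heq₀⟩, fun ψ => ⟨fun hψ => ?_, ?_⟩⟩, ?_⟩
  · obtain ⟨hψa, hψe⟩ := (hiff ψ).1 hψ
    obtain ⟨g, hg, hψg⟩ := hψa.exists_convexOn hvol hγ₀ hψe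
    have hge := ae_sum_eq_of_coe hψe hψg
    have hconst := sub_eq_sub_of_ae_eq hac hvol hγ₀ hg₀ hle₀ hge₀ hg
      (detVec_le_sum_of_coe hψa hψg) hge
    -- At a point tight for both tuples the two sums equal `detVec z`, so the constants read off
    -- there add up to zero.
    obtain ⟨z, hz, hz₀⟩ := (hge.and hge₀).exists
    refine ⟨fun i => g i (z i) - g₀ i (z i), ?_, fun i x => ?_⟩
    · rw [Finset.sum_sub_distrib, hz, hz₀, sub_self]
    · rw [hψg, hφg₀, ← EReal.coe_add, EReal.coe_eq_coe_iff]
      linarith [hconst i x (z i)]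
  · rintro ⟨c, hc, hψ⟩
    have hψg : ∀ i y, ψ i y = ((g₀ i y + c i : ℝ) : EReal) := fun i y => by
      rw [hψ, hφg₀, EReal.coe_add]
    have hsum : ∀ x : Fin d → Vec d, ∑ i, ψ i (x i) = ((∑ i, g₀ i (x i) : ℝ) : EReal) := by
      intro x
      simp only [hψg]
      rw [← ereal_coe_sum, Finset.sum_add_distrib, hc, add_zero]
    refine (hiff ψ).2 ⟨⟨fun i => ?_, fun i x => ?_, fun x => ?_⟩, ?_⟩
    · have hcont := (hg₀ i).locallyLipschitz.continuous
      rw [funext (hψg i)]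
      exact Continuous.lowerSemicontinuous
        (continuous_coe_real_ereal.comp (hcont.add continuous_const))
    · rw [hψg]
      exact EReal.coe_ne_bot _
    · rw [hsum, EReal.coe_le_coe_iff]
      exact hle₀ x
    · filter_upwards [hge₀] with x hx
      rw [hsum, hx]
  · intro φ hφ γ hγp hγ i
    obtain ⟨hφa, hφe⟩ := (hiff φ).1 hφ
    have hcost := (dualCost_eq_integral_iff hnorm hγ₀ (hdet hγ₀) hφa).2 hφe
    -- Optimality of `γ` against `γ₀` and weak duality on `γ` match the values, so `φ` is tight on
    -- `γ` as well.
    have hval : dualCost μ φ = ((∫ x, detVec x ∂γ : ℝ) : EReal) := by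
      refine le_antisymm ?_ (integral_detVec_le_dualCost hnorm hγ.1 (hdet hγ.1) hφa)
      rw [hcost, EReal.coe_le_coe_iff]
      exact hγ.2 γ₀ hγ₀
    have heq := (dualCost_eq_integral_iff hnorm hγ.1 (hdet hγ.1) hφa).1 hval
    obtain ⟨g, hg, hφg⟩ := hφa.exists_convexOn hvol hγ.1 heq
    have hgrad := ae_hasGradientAt hac hγ.1 hg (detVec_le_sum_of_coe hφa hφg)
      (ae_sum_eq_of_coe heq hφg) i
    filter_upwards [ae_hasGradientAt_integral hγ.1 hgrad] with a ha
    refine ⟨.of_forall fun b => ?_, ha.1, ?_⟩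
    · rw [hφg]
      exact EReal.coe_ne_top _
    · simpa only [hφg, EReal.toReal_coe] using ha.2
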